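/- Let $N\ge 2$ be an integer and $d,l,\alpha>0$. Let $\mathcal{Q}(N,d,l,\alpha)$ be the class of full-dimensional convex polytopes in $\mathbb{R}^N$ that have diameter at most $d$, all face inscription sizes at least $l$, and all exterior dihedral angles at least $\alpha$. Here "face" means a face of dimension $N-1$; the inscription size of a face is the diameter of the largest $(N-1)$-dimensional disk contained in that face; and the exterior dihedral angle between two adjacent faces (two faces meeting in a face of dimension $N-2$) is the angle between their outward unit normals, i.e. $\pi$ minus the interior dihedral angle. Assume $Q\in\mathcal{Q}(N,d,l,\alpha)$. Then there are finitely many distinct directions $v_1,\dots,v_M\in\mathbb{S}^{N-1}$ such that: 1. for every observation point $x_o\in Q$ and every face $F$ of $Q$, at least $N$ of the rays $\mathfrak{R}_i=\{x_o+tv_i \mid t\in[0,\infty)\}$, $1\le i\le M$, intersect $F$; and 2. the number of rays satisfies $$M\;\le\;\sqrt{2\pi N}\left(\frac{1}{\sin\left(\frac{1}{12}\theta_{\min}\right)}\right)^{N-1},\qquad \theta_{\min}=\arcsin\left(\frac{l}{d}\sin\alpha\right).$$ -/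

import Mathlib

open scoped RealInnerProductSpace

noncomputable section

/-- A (full-dimensional) convex polytope in `ℝ^N`: the convex hull of finitely many points,
with nonempty interior. -/
def IsConvexPolytope {N : ℕ} (Q : Set (EuclideanSpace ℝ (Fin N))) : Prop :=
  (∃ s : Finset (EuclideanSpace ℝ (Fin N)), Q = convexHull ℝ (s : Set (EuclideanSpace ℝ (Fin N)))) ∧
    (interior Q).Nonempty

/-- `F` is a face of codimension one (a facet) of `Q`: a nonempty exposed subset whose affine span
has dimension `N - 1`. -/
def IsPolytopeFace {N : ℕ} (Q F : Set (EuclideanSpace ℝ (Fin N))) : Prop :=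
  F.Nonempty ∧ IsExposed ℝ Q F ∧ Module.finrank ℝ (vectorSpan ℝ F) + 1 = N

/-- `n` is the outward unit normal of the face `F` of `Q`: the points of `F` are exactly the points
of `Q` that lie farthest in the direction `n`. -/
def IsOutwardUnitNormal {N : ℕ} (Q F : Set (EuclideanSpace ℝ (Fin N)))
    (n : EuclideanSpace ℝ (Fin N)) : Prop :=
  ‖n‖ = 1 ∧ F = {x ∈ Q | ∀ y ∈ Q, ⟪n, y⟫ ≤ ⟪n, x⟫}

/-- Two different faces are adjacent if they meet in an `(N - 2)`-dimensional set. -/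
def AreAdjacentFaces {N : ℕ} (F G : Set (EuclideanSpace ℝ (Fin N))) : Prop :=
  F ≠ G ∧ (F ∩ G).Nonempty ∧ Module.finrank ℝ (vectorSpan ℝ (F ∩ G)) + 2 = N

/-- The inscription size of a face `F`: the diameter of the largest `(N - 1)`-dimensional disk
(ball of the affine span of `F`) that is contained in `F`. -/
def inscriptionSize {N : ℕ} (F : Set (EuclideanSpace ℝ (Fin N))) : ℝ :=
  sSup {δ : ℝ | 0 ≤ δ ∧ ∃ c ∈ affineSpan ℝ F,
    Metric.closedBall c (δ / 2) ∩ (affineSpan ℝ F : Set (EuclideanSpace ℝ (Fin N))) ⊆ F}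

/-- The class `𝒬(N, d, l, α)` of convex polytopes in `ℝ^N` with diameter at most `d`, all face
inscription sizes at least `l`, and all exterior dihedral angles at least `α`. The exterior
dihedral angle at two adjacent faces is the angle between their outward unit normals (that is,
`π` minus the dihedral angle inside the polytope). -/
def polytopeClass (N : ℕ) (d l α : ℝ) : Set (Set (EuclideanSpace ℝ (Fin N))) :=
  {Q | IsConvexPolytope Q ∧
    Metric.diam Q ≤ d ∧
    (∀ F, IsPolytopeFace Q F → l ≤ inscriptionSize F) ∧
    (∀ F G m n, IsPolytopeFace Q F → IsPolytopeFace Q G → AreAdjacentFaces F G →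
      IsOutwardUnitNormal Q F m → IsOutwardUnitNormal Q G n →
        α ≤ InnerProductGeometry.angle m n)}

/-- The ray based at `x` in the direction `v`. -/
def rayFrom {N : ℕ} (x v : EuclideanSpace ℝ (Fin N)) : Set (EuclideanSpace ℝ (Fin N)) :=
  {y | ∃ t : ℝ, 0 ≤ t ∧ y = x + t • v}

/-- The angle `θ_min = arcsin ((l / d) sin α)`. -/
def thetaMin (d l α : ℝ) : ℝ := Real.arcsin (l / d * Real.sin α)

end

/-! The directions form a maximal set `V` of unit vectors with pairwise angles at least δ = θ_min /
6; it depends on the polytope only through the parameters. Maximality makes `V` δ-dense on the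
sphere. The caps of radius δ / 2 = θ_min / 12 around its points are disjoint, and comparing the
volumes of their sectors with the volume of the unit ball gives the bound on M
(`exists_dense_directions`).

It remains to see that the directions in which a facet `F` is visible from a point `x` of the
polytope always include N points of `V`. By density this holds as soon as they contain a cap of
radius 2δ (`finrank_le_card_of_cap`), or a δ-cap together with a ring of δ-caps at distance at least
2δ from it (`finrank_le_card_of_cap_of_rim`). The visible directions are cut out by the hyperplane
parallel to `F` and the hyperplanes through `x` and the ridges of `F`. The normals of the latter are
`A • e - B • ν`, with `e` the normal of `F` and `ν ⟂ e`. The inscribed disk and the dihedral angle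
each restrict (A, B) to an arc of the unit circle (`AdmissibleNormal`, `ray_meets_facet`). A linear
function on such an arc that is bounded below by μ ≥ 0 at the ends is so everywhere, so caps are
located by checking endpoints.

After scaling the disk to radius 1, let `h` be the distance from `x` to the hyperplane of `F`, `R`
the distance from the projection of `x` to the centre of the disk, and `d` the distance from `x` to
the far end of the disk. The choice of δ gives sin 6δ · d ≤ 2 sin α. A single 2δ-cap is found if R ≤
1, if N = 2, or if the facet is seen steeply; for N ≥ 3 and a flat view, the cap with a ring is used
(`finrank_le_card_of_admissible`). -/

/-! ### Counting points of a dense subset of the sphere. -/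

section SphericalCovering

variable {E : Type*} [NormedAddCommGroup E] [InnerProductSpace ℝ E]

/-- At most `dim W` vectors leave room for a unit vector of `W` making no acute angle with any
of them. -/
theorem exists_unit_inner_nonpos [FiniteDimensional ℝ E] (W : Submodule ℝ E) (T : Finset E)
    (hT : T.card ≤ Module.finrank ℝ W) (hW : 0 < Module.finrank ℝ W) :
    ∃ σ ∈ W, ‖σ‖ = 1 ∧ ∀ v ∈ T, ⟪v, σ⟫ ≤ 0 := by
  suffices h : ∃ σ ∈ W, σ ≠ 0 ∧ ∀ v ∈ T, ⟪v, σ⟫ ≤ 0 by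
    obtain ⟨σ, hσW, hσ, h⟩ := h
    refine ⟨‖σ‖⁻¹ • σ, W.smul_mem _ hσW, ?_, fun v hv => ?_⟩
    · rw [norm_smul, norm_inv, norm_norm, inv_mul_cancel₀ (norm_ne_zero_iff.mpr hσ)]
    · rw [real_inner_smul_right]
      exact mul_nonpos_of_nonneg_of_nonpos (by positivity) (h v hv)
  let φ : W →ₗ[ℝ] (T → ℝ) := LinearMap.pi fun v => (innerₛₗ ℝ (v : E)).comp W.subtype
  have hφ : ∀ (σ : W) (v : T), φ σ v = ⟪(v : E), (σ : E)⟫ := fun σ v => rfl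
  -- Either some nonzero vector of `W` is orthogonal to all of `T`, or the cardinality bound makes
  -- `φ` bijective and the constant -1 is a value.
  by_cases hinj : Function.Injective φ
  · have hcard : Module.finrank ℝ W = Module.finrank ℝ (T → ℝ) := by
      refine le_antisymm (LinearMap.finrank_le_finrank_of_injective hinj) ?_
      simpa using hT
    have hsurj := (LinearMap.injective_iff_surjective_of_finrank_eq_finrank hcard).1 hinj
    obtain ⟨σ, hσ⟩ := hsurj fun _ => -1
    have hne : T.Nonempty := by
      rw [← Finset.card_pos]
      simpa [hcard] using hW
    obtain ⟨v₀, hv₀⟩ := hne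
    refine ⟨σ, σ.2, fun h0 => ?_, fun v hv => ?_⟩
    · have := congrFun hσ ⟨v₀, hv₀⟩
      rw [hφ, h0, inner_zero_right] at this
      norm_num at this
    · have := congrFun hσ ⟨v, hv⟩
      rw [hφ] at this
      rw [this]
      norm_num
  · rw [← LinearMap.ker_eq_bot, Submodule.eq_bot_iff] at hinj
    push Not at hinj
    obtain ⟨σ, hσ, hne⟩ := hinj
    refine ⟨σ, σ.2, by simpa using hne, fun v hv => ?_⟩
    have := congrFun (LinearMap.mem_ker.1 hσ) ⟨v, hv⟩
    rw [hφ] at this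
    exact this.le

open InnerProductGeometry

theorem le_angle_of_inner_le_cos {u v : E} (hu : ‖u‖ = 1) (hv : ‖v‖ = 1) {δ : ℝ} (h0 : 0 ≤ δ)
    (hπ : δ ≤ Real.pi) (h : ⟪u, v⟫ ≤ Real.cos δ) : δ ≤ angle u v := by
  rw [angle, hu, hv, mul_one, div_one, ← Real.arccos_cos h0 hπ]
  exact Real.antitone_arccos h

theorem finrank_orthogonal_span_singleton_add_one [FiniteDimensional ℝ E] {u : E} (hu : u ≠ 0) :
    Module.finrank ℝ (ℝ ∙ u)ᗮ + 1 = Module.finrank ℝ E := by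
  rw [← Submodule.finrank_add_finrank_orthogonal (ℝ ∙ u), finrank_span_singleton hu, add_comm]

open Classical in
/-- A set containing a spherical cap of radius `2 δ` contains at least `dim E` points of a
`δ`-dense subset of the sphere. -/
theorem finrank_le_card_of_cap [FiniteDimensional ℝ E] {S : Finset E} {δ : ℝ} (hS : ∀ v ∈ S, ‖v‖ = 1)
    (hcov : ∀ u : E, ‖u‖ = 1 → ∃ v ∈ S, angle u v < δ) (hδ0 : 0 < δ) (hδ : δ ≤ Real.pi / 2)
    (hE : 2 ≤ Module.finrank ℝ E) {K : Set E} {u : E} (hu : ‖u‖ = 1)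
    (hK : ∀ v, ‖v‖ = 1 → angle u v < 2 * δ → v ∈ K) :
    Module.finrank ℝ E ≤ (S.filter (· ∈ K)).card := by
  by_contra! hlt
  have hu0 : u ≠ 0 := norm_ne_zero_iff.1 (by rw [hu]; exact one_ne_zero)
  have hfr := finrank_orthogonal_span_singleton_add_one hu0
  obtain ⟨σ, hσW, hσ, hσT⟩ := exists_unit_inner_nonpos (ℝ ∙ u)ᗮ (S.filter (· ∈ K)) (by omega)
    (by omega)
  have huσ : ⟪u, σ⟫ = 0 := Submodule.mem_orthogonal_singleton_iff_inner_right.1 hσW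
  -- `p` is at angle δ from `u`, tilted away from the counted points. A point `v` of `S` within δ of
  -- `p` is within 2δ of `u`, hence counted, and ⟪p, v⟫ ≤ cos δ · ⟪u, v⟫ ≤ cos δ contradicts its
  -- closeness to `p`.
  set p := Real.cos δ • u + Real.sin δ • σ with hp
  have hpn : ‖p‖ = 1 := by
    have : ‖p‖ ^ 2 = 1 := by
      rw [hp, norm_add_sq_real, norm_smul, norm_smul, real_inner_smul_left, real_inner_smul_right,
        huσ, hu, hσ, Real.norm_eq_abs, Real.norm_eq_abs, mul_one, mul_one, sq_abs, sq_abs]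
      linarith [Real.sin_sq_add_cos_sq δ]
    exact (pow_eq_one_iff_of_nonneg (norm_nonneg _) two_ne_zero).1 this
  have hup : angle u p = δ := by
    rw [angle, hu, hpn, mul_one, div_one, hp, inner_add_right, real_inner_smul_right,
      real_inner_smul_right, huσ, real_inner_self_eq_norm_sq, hu]
    simp [Real.arccos_cos hδ0.le (by linarith [Real.pi_pos])]
  obtain ⟨v, hvS, hv⟩ := hcov p hpn
  have hvK : v ∈ K := hK v (hS v hvS) (by linarith [angle_le_angle_add_angle u p v])
  have hvT := hσT v (Finset.mem_filter.2 ⟨hvS, hvK⟩)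
  have hcos : 0 ≤ Real.cos δ := Real.cos_nonneg_of_mem_Icc ⟨by linarith, hδ⟩
  have hsin : 0 ≤ Real.sin δ := Real.sin_nonneg_of_nonneg_of_le_pi hδ0.le
    (by linarith [Real.pi_pos])
  have huv : ⟪u, v⟫ ≤ 1 := by
    simpa [hu, hS v hvS] using real_inner_le_norm u v
  have : δ ≤ angle p v := by
    refine le_angle_of_inner_le_cos hpn (hS v hvS) hδ0.le (by linarith [Real.pi_pos]) ?_
    rw [hp, inner_add_left, real_inner_smul_left, real_inner_smul_left, real_inner_comm v σ]
    nlinarith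
  linarith

open Classical in
/-- A set containing a cap of radius `δ` and a family of caps of radius `δ` centred on a sphere of
codimension two, all far from the first one, contains at least `dim E` points of a `δ`-dense subset
of the sphere. -/
theorem finrank_le_card_of_cap_of_rim [FiniteDimensional ℝ E] {S : Finset E} {δ : ℝ} (hS : ∀ v ∈ S, ‖v‖ = 1)
    (hcov : ∀ u : E, ‖u‖ = 1 → ∃ v ∈ S, angle u v < δ) (hδ0 : 0 < δ) (hδ : δ ≤ Real.pi / 4)
    {K : Set E} {W : Submodule ℝ E} (hW : Module.finrank ℝ E ≤ Module.finrank ℝ W + 2)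
    (hW0 : 0 < Module.finrank ℝ W) {a b : E} {g : ℝ} (hg : 0 ≤ g)
    (hcapa : ∀ v, ‖v‖ = 1 → angle a v < δ → v ∈ K)
    (hcapb : ∀ σ ∈ W, ‖σ‖ = 1 → ∀ v, ‖v‖ = 1 → angle (b + g • σ) v < δ → v ∈ K)
    (ha : a ≠ 0) (hb0 : b ≠ 0) (hb : ∀ σ ∈ W, ⟪b, σ⟫ = 0) (hgb : Real.sin δ ^ 2 * (‖b‖ ^ 2 + g ^ 2) ≤ g ^ 2)
    (hab : ∀ σ ∈ W, ‖σ‖ = 1 → ⟪a, b + g • σ⟫ ≤ Real.cos (2 * δ) * (‖a‖ * ‖b + g • σ‖)) :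
    Module.finrank ℝ E ≤ (S.filter (· ∈ K)).card := by
  by_contra! hlt
  have hπ := Real.pi_pos
  have han : 0 < ‖a‖ := norm_pos_iff.2 ha
  have hbn : 0 < ‖b‖ := norm_pos_iff.2 hb0
  obtain ⟨v₀, hv₀S, hv₀⟩ := hcov (‖a‖⁻¹ • a)
    (by rw [norm_smul, norm_inv, norm_norm, inv_mul_cancel₀ han.ne'])
  rw [angle_smul_left_of_pos _ _ (inv_pos.2 han)] at hv₀
  have hv₀T : v₀ ∈ S.filter (· ∈ K) :=
    Finset.mem_filter.2 ⟨hv₀S, hcapa v₀ (hS v₀ hv₀S) hv₀⟩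
  -- Without `v₀` at most dim E - 2 points are left, which `W` can avoid. The point `v₁` near the
  -- ring differs from `v₀`, because the ring is 2δ away from `a`, so `σ` tilts away from it too.
  obtain ⟨σ, hσW, hσ, hσT⟩ := exists_unit_inner_nonpos W ((S.filter (· ∈ K)).erase v₀)
    (by rw [Finset.card_erase_of_mem hv₀T]; omega) hW0
  set p := b + g • σ with hp
  have hpsq : ‖p‖ ^ 2 = ‖b‖ ^ 2 + g ^ 2 := by
    rw [hp, norm_add_sq_real, real_inner_smul_right, hb σ hσW, norm_smul, hσ, Real.norm_eq_abs,
      mul_one, sq_abs]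
    ring
  have hpn : 0 < ‖p‖ := by
    have : 0 < ‖p‖ ^ 2 := by rw [hpsq]; positivity
    exact norm_pos_iff.2 fun h0 => by simp [h0] at this
  have hap : 2 * δ ≤ angle a p := by
    rw [angle, ← Real.arccos_cos (by linarith : 0 ≤ 2 * δ) (by linarith)]
    exact Real.antitone_arccos ((div_le_iff₀ (by positivity)).2 (hab σ hσW hσ))
  obtain ⟨v₁, hv₁S, hv₁⟩ := hcov (‖p‖⁻¹ • p)
    (by rw [norm_smul, norm_inv, norm_norm, inv_mul_cancel₀ hpn.ne'])
  rw [angle_smul_left_of_pos _ _ (inv_pos.2 hpn)] at hv₁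
  have hv₁K := hcapb σ hσW hσ v₁ (hS v₁ hv₁S) hv₁
  by_cases hvv : v₁ = v₀
  · subst hvv
    have := angle_le_angle_add_angle a v₁ p
    rw [angle_comm v₁ p] at this
    linarith
  have hT := hσT v₁ (Finset.mem_erase.2 ⟨hvv, Finset.mem_filter.2 ⟨hv₁S, hv₁K⟩⟩)
  have hcos : 0 < Real.cos δ := Real.cos_pos_of_mem_Ioo ⟨by linarith, by linarith⟩
  have hbp : ‖b‖ ≤ Real.cos δ * ‖p‖ := by
    refine abs_le_of_sq_le_sq' ?_ (by positivity) |>.2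
    rw [mul_pow, hpsq]
    nlinarith [Real.sin_sq_add_cos_sq δ]
  have : δ ≤ angle p v₁ := by
    rw [angle, ← Real.arccos_cos hδ0.le (by linarith : δ ≤ Real.pi)]
    refine Real.antitone_arccos ((div_le_iff₀ (by rw [hS v₁ hv₁S, mul_one]; exact hpn)).2 ?_)
    have h4 : ⟪b, v₁⟫ ≤ ‖b‖ := by simpa [hS v₁ hv₁S] using real_inner_le_norm b v₁
    rw [hS v₁ hv₁S, mul_one, hp, inner_add_left, real_inner_smul_left, real_inner_comm v₁ σ]
    nlinarith
  linarith

/-- If `U` makes an angle at most `π / 2 - κ` with the unit vector `m`, then the cap of radius `κ`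
around `U` lies in the open half space of `m`. -/
theorem inner_pos_of_angle_lt {U m v : E} {κ : ℝ} (hU : U ≠ 0) (hm : ‖m‖ = 1) (hκ0 : 0 ≤ κ)
    (hκ : κ ≤ Real.pi / 2) (h : Real.sin κ * ‖U‖ ≤ ⟪U, m⟫) (hv : ‖v‖ = 1) (hUv : angle U v < κ) :
    0 < ⟪v, m⟫ := by
  have hUn : 0 < ‖U‖ := norm_pos_iff.2 hU
  have h1 : angle U m ≤ Real.pi / 2 - κ := by
    rw [angle, ← Real.arccos_cos (by linarith : 0 ≤ Real.pi / 2 - κ) (by linarith [Real.pi_pos])]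
    refine Real.antitone_arccos ?_
    rw [Real.cos_pi_div_two_sub, hm, mul_one, le_div_iff₀ hUn]
    exact h
  have h2 := angle_le_angle_add_angle v U m
  rw [angle_comm v U] at h2
  have h3 : 0 < Real.cos (angle v m) :=
    Real.cos_pos_of_mem_Ioo ⟨by linarith [angle_nonneg v m, Real.pi_pos], by linarith⟩
  rw [cos_angle, hv, hm] at h3
  simpa using h3

end SphericalCovering

/-! ### Comparing sin 6δ with sin 2δ and sin δ. -/

section TrigonometricBounds

variable {δ : ℝ}

theorem sin_two_mul_le_half (h6 : 6 * δ ≤ Real.pi / 2) (h0 : 0 < δ) : Real.sin (2 * δ) ≤ 1 / 2 := by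
  rw [← Real.sin_pi_div_six]
  exact Real.sin_le_sin_of_le_of_le_pi_div_two (by linarith [Real.pi_pos]) (by linarith)
    (by linarith)

theorem sin_six_mul_eq (δ : ℝ) :
    Real.sin (6 * δ) = 3 * Real.sin (2 * δ) - 4 * Real.sin (2 * δ) ^ 3 := by
  rw [← Real.sin_three_mul]
  ring_nf

theorem two_mul_sin_two_mul_le (h6 : 6 * δ ≤ Real.pi / 2) (h0 : 0 < δ) :
    2 * Real.sin (2 * δ) ≤ Real.sin (6 * δ) := by
  have h1 := sin_two_mul_le_half h6 h0
  have h2 : 0 ≤ Real.sin (2 * δ) :=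
    Real.sin_nonneg_of_nonneg_of_le_pi (by linarith) (by linarith [Real.pi_pos])
  rw [sin_six_mul_eq]
  nlinarith [mul_nonneg h2 (sub_nonneg.2 h1), mul_nonneg (mul_nonneg h2 h2) (sub_nonneg.2 h1)]

/-- Together with sin 6δ · d ≤ 2S this yields sin² 2δ · (d² - (20/9) S²) ≤ ((2/3) S)², so that a
vector with ‖U‖² + (20/9) S² ≤ d² and margin (2/3) S carries a 2δ-cap. -/
theorem nine_mul_sin_two_mul_sq_le (h6 : 6 * δ ≤ Real.pi / 2) (h0 : 0 < δ) :
    9 * Real.sin (2 * δ) ^ 2 ≤ Real.sin (6 * δ) ^ 2 * (1 + 5 * Real.sin (2 * δ) ^ 2) := by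
  have h1 := sin_two_mul_le_half h6 h0
  have h2 : 0 ≤ Real.sin (2 * δ) :=
    Real.sin_nonneg_of_nonneg_of_le_pi (by linarith) (by linarith [Real.pi_pos])
  rw [sin_six_mul_eq]
  set y := Real.sin (2 * δ) ^ 2 with hy
  have hy0 : 0 ≤ y := sq_nonneg _
  have hy1 : y ≤ 1 / 4 := by rw [hy]; nlinarith
  -- This product is exactly the difference of the two sides; the factor 1/4 - y vanishes at 6δ =
  -- π/2, where the inequality is sharp.
  have key : 0 ≤ y ^ 2 * (1 / 4 - y) * (84 - 80 * y) :=
    mul_nonneg (mul_nonneg (sq_nonneg y) (by linarith)) (by linarith)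
  have e : (3 * Real.sin (2 * δ) - 4 * Real.sin (2 * δ) ^ 3) ^ 2 = y * (3 - 4 * y) ^ 2 := by
    rw [hy]; ring
  rw [e]
  nlinarith

theorem sin_two_mul_le_two_mul_sin (h6 : 6 * δ ≤ Real.pi / 2) (h0 : 0 < δ) :
    Real.sin (2 * δ) ≤ 2 * Real.sin δ := by
  have h2 : 0 ≤ Real.sin δ :=
    Real.sin_nonneg_of_nonneg_of_le_pi (by linarith) (by linarith [Real.pi_pos])
  rw [Real.sin_two_mul]
  nlinarith [Real.cos_le_one δ]

/-- The counterpart for δ-caps: it yields sin² δ · (d² - 2S²) ≤ (S/3)². The bound 3/4 keeps 6δ ≤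
π/3, where sin² 6δ is a tame polynomial in sin² δ. -/
theorem thirtysix_mul_sin_sq_le (h6 : 6 * δ ≤ Real.pi / 2) (h0 : 0 < δ)
    (hs : Real.sin (6 * δ) ^ 2 ≤ 3 / 4) :
    36 * Real.sin δ ^ 2 ≤ Real.sin (6 * δ) ^ 2 * (1 + 18 * Real.sin δ ^ 2) := by
  have hπ := Real.pi_pos
  have h3 : 6 * δ ≤ Real.pi / 3 := by
    by_contra! hlt
    have h := Real.sin_lt_sin_of_lt_of_le_pi_div_two (by linarith) h6 hlt
    rw [Real.sin_pi_div_three] at h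
    have h' := mul_self_lt_mul_self (by positivity) h
    have : √3 * √3 = 3 := Real.mul_self_sqrt (by norm_num)
    nlinarith
  have hδ : δ ≤ 0.175 := by linarith [Real.pi_lt_d2]
  have h2 : 0 ≤ Real.sin δ := Real.sin_nonneg_of_nonneg_of_le_pi h0.le (by linarith)
  have h1 : Real.sin δ ≤ 0.175 := (Real.sin_le h0.le).trans hδ
  set z := Real.sin δ ^ 2 with hz
  have hz0 : 0 ≤ z := sq_nonneg _
  have hz1 : z ≤ 0.031 := by rw [hz]; nlinarith
  have e : Real.sin (6 * δ) ^ 2 = 4 * (z * (3 - 4 * z) ^ 2) * (1 - z * (3 - 4 * z) ^ 2) := by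
    have e1 : Real.sin (6 * δ) = 2 * Real.sin (3 * δ) * Real.cos (3 * δ) := by
      rw [← Real.sin_two_mul]; ring_nf
    have e2 : Real.sin (3 * δ) ^ 2 = z * (3 - 4 * z) ^ 2 := by
      rw [Real.sin_three_mul, hz]; ring
    have e3 := Real.sin_sq_add_cos_sq (3 * δ)
    rw [e1, mul_pow, mul_pow, ← e2, show Real.cos (3 * δ) ^ 2 = 1 - Real.sin (3 * δ) ^ 2 by linarith]
    norm_num
  rw [e]
  have a1 : 9 - 24 * z ≤ (3 - 4 * z) ^ 2 := by nlinarith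
  have a2 : 1 - 9 * z ≤ 1 - z * (3 - 4 * z) ^ 2 := by nlinarith
  have a3 : (9 - 24 * z) * (1 - 9 * z) ≤ (3 - 4 * z) ^ 2 * (1 - z * (3 - 4 * z) ^ 2) :=
    mul_le_mul a1 a2 (by linarith) (by positivity)
  have a4 : 9 ≤ (9 - 24 * z) * (1 - 9 * z) * (1 + 18 * z) := by
    nlinarith [mul_nonneg hz0 (sub_nonneg.2 hz1), mul_nonneg hz0 (sq_nonneg z)]
  have a5 := mul_le_mul_of_nonneg_right a3 (by linarith : (0 : ℝ) ≤ 1 + 18 * z)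
  nlinarith [mul_le_mul_of_nonneg_left (a4.trans a5) hz0]

end TrigonometricBounds

/-! ### Lower bounds for pairings with admissible normals. -/

section AdmissibleNormals

variable {E : Type*} [NormedAddCommGroup E] [InnerProductSpace ℝ E]

/-- The unit normals `A e - B ν` of the hyperplanes through an observation point at height `h` below
the hyperplane `e^⊥`, that contain a ridge of the facet with normal `ν`, where the facet contains
the unit disk centred at `w` and the dihedral angle between the two hyperplanes is at most
`π - arg (c + S i)`. -/
def AdmissibleNormal (e w : E) (h S c : ℝ) (m : E) : Prop :=
  ∃ (ν : E) (A B : ℝ), ‖ν‖ = 1 ∧ ⟪ν, e⟫ = 0 ∧ 0 ≤ B ∧ A ^ 2 + B ^ 2 = 1 ∧ 0 ≤ S * A + c * B ∧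
    B * (1 + ⟪ν, w⟫) ≤ h * A ∧ m = A • e - B • ν

theorem AdmissibleNormal.norm_eq_one {e w m : E} {h S c : ℝ} (hm : AdmissibleNormal e w h S c m)
    (he : ‖e‖ = 1) : ‖m‖ = 1 := by
  obtain ⟨ν, A, B, hν, hνe, -, hAB, -, -, rfl⟩ := hm
  have : ‖A • e - B • ν‖ ^ 2 = 1 := by
    rw [norm_sub_sq_real, norm_smul, norm_smul, real_inner_smul_left, real_inner_smul_right,
      real_inner_comm, hνe, he, hν, Real.norm_eq_abs, Real.norm_eq_abs, mul_one, mul_one, sq_abs,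
      sq_abs]
    linarith
  exact (pow_eq_one_iff_of_nonneg (norm_nonneg _) two_ne_zero).1 this

theorem one_le_add_of_unit_combination {A B a₁ b₁ a₂ b₂ i j : ℝ} (hAB : A ^ 2 + B ^ 2 = 1)
    (h₁ : a₁ ^ 2 + b₁ ^ 2 = 1) (h₂ : a₂ ^ 2 + b₂ ^ 2 = 1) (hi : 0 ≤ i) (hj : 0 ≤ j)
    (hA : A = i * a₁ + j * a₂) (hB : B = i * b₁ + j * b₂) : 1 ≤ i + j := by
  have h : a₁ * a₂ + b₁ * b₂ ≤ 1 := by nlinarith [sq_nonneg (a₁ - a₂), sq_nonneg (b₁ - b₂)]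
  have h' : 1 ≤ (i + j) ^ 2 := by
    have : A ^ 2 + B ^ 2 = i ^ 2 * (a₁ ^ 2 + b₁ ^ 2) + j ^ 2 * (a₂ ^ 2 + b₂ ^ 2)
        + 2 * (i * j) * (a₁ * a₂ + b₁ * b₂) := by rw [hA, hB]; ring
    rw [hAB, h₁, h₂] at this
    nlinarith [mul_nonneg hi hj]
  nlinarith

/-- A linear functional that is at least `μ` at two unit vectors is at least `μ` at every unit
vector between them. -/
theorem le_of_unit_combination {A B a₁ b₁ a₂ b₂ i j p q μ : ℝ} (hAB : A ^ 2 + B ^ 2 = 1)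
    (h₁ : a₁ ^ 2 + b₁ ^ 2 = 1) (h₂ : a₂ ^ 2 + b₂ ^ 2 = 1) (hi : 0 ≤ i) (hj : 0 ≤ j)
    (hA : A = i * a₁ + j * a₂) (hB : B = i * b₁ + j * b₂) (hμ : 0 ≤ μ)
    (hv₁ : μ ≤ p * a₁ + q * b₁) (hv₂ : μ ≤ p * a₂ + q * b₂) : μ ≤ p * A + q * B := by
  have h := one_le_add_of_unit_combination hAB h₁ h₂ hi hj hA hB
  have e : p * A + q * B = i * (p * a₁ + q * b₁) + j * (p * a₂ + q * b₂) := by rw [hA, hB]; ring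
  rw [e]
  nlinarith [mul_le_mul_of_nonneg_left hv₁ hi, mul_le_mul_of_nonneg_left hv₂ hj]

variable {e w : E} {h S c : ℝ}

/-- The disk condition eliminates `w` and leaves at least t A + (1 - g) B. The pair (A, B) lies on
the arc from (1, 0) to (-c, S), the dihedral extreme, and the endpoint values are t and (1 - g) S -
t c. -/
theorem AdmissibleNormal.le_inner {m z : E} {t g μ : ℝ} (hm : AdmissibleNormal e w h S c m)
    (he : ‖e‖ = 1) (hwe : ⟪e, w⟫ = 0) (hze : ⟪e, z⟫ = 0) (hzg : ‖z‖ ≤ g) (hS : 0 < S)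
    (hSc : S ^ 2 + c ^ 2 = 1) (hμ : 0 ≤ μ) (hμt : μ ≤ t) (hμS : μ ≤ (1 - g) * S - t * c) :
    μ ≤ ⟪(h + t) • e + w + z, m⟫ := by
  obtain ⟨ν, A, B, hν, hνe, hB, hAB, hSA, hw, rfl⟩ := hm
  have e1 : ⟪(h + t) • e + w + z, A • e - B • ν⟫ = (h + t) * A - B * ⟪ν, w⟫ - B * ⟪ν, z⟫ := by
    simp only [inner_add_left, inner_sub_right, real_inner_smul_left, real_inner_smul_right,
      real_inner_self_eq_norm_sq, he, real_inner_comm e w, real_inner_comm e z, hwe, hze,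
      real_inner_comm ν e, hνe, real_inner_comm ν w, real_inner_comm ν z]
    ring
  have hz : ⟪ν, z⟫ ≤ g := by
    have := real_inner_le_norm ν z
    rw [hν, one_mul] at this
    exact this.trans hzg
  have hz' := mul_le_mul_of_nonneg_left hz hB
  have hv : μ ≤ t * A + (1 - g) * B := by
    refine le_of_unit_combination (a₁ := 1) (b₁ := 0) (a₂ := -c) (b₂ := S) (i := A + c * (B / S))
      (j := B / S) hAB (by norm_num) (by linarith) ?_ (by positivity) (by ring) (by field_simp; ring)
      hμ (by linarith) (by linarith)
    have : A + c * (B / S) = (S * A + c * B) / S := by field_simp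
    rw [this]
    positivity
  rw [e1]
  linarith

/-- Two lower bounds are available: t A + B from the disk condition and (h + t) A - R B from
Cauchy–Schwarz. They agree at (A, B) = ((R + 1) / d, h / d), the normal to the line of sight to the
far end of the disk. Using each on its own side of that point gives the values h + t, (h + t (R +
1)) / d and S - t c at the ends of the arcs. -/
theorem AdmissibleNormal.le_inner_of_disk {m : E} {t μ R d : ℝ} (hm : AdmissibleNormal e w h S c m)
    (he : ‖e‖ = 1) (hwe : ⟪e, w⟫ = 0) (hw : ‖w‖ = R) (hh : 0 < h) (hS : 0 < S) (hc : 0 ≤ c)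
    (hSc : S ^ 2 + c ^ 2 = 1) (hd0 : 0 < d) (hd : d ^ 2 = h ^ 2 + (R + 1) ^ 2) (ht : 0 ≤ t)
    (hμ : 0 ≤ μ) (hμd : μ * d ≤ h + t * (R + 1)) (hμS : μ ≤ S - t * c) :
    μ ≤ ⟪(h + t) • e + w, m⟫ := by
  obtain ⟨ν, A, B, hν, hνe, hB, hAB, hSA, hwm, rfl⟩ := hm
  have hR : 0 ≤ R := hw ▸ norm_nonneg w
  have e1 : ⟪(h + t) • e + w, A • e - B • ν⟫ = (h + t) * A - B * ⟪ν, w⟫ := by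
    simp only [inner_add_left, inner_sub_right, real_inner_smul_left, real_inner_smul_right,
      real_inner_self_eq_norm_sq, he, real_inner_comm e w, hwe,
      real_inner_comm ν e, hνe, real_inner_comm ν w]
    ring
  have hz : ⟪ν, w⟫ ≤ R := by
    have := real_inner_le_norm ν w
    rwa [hν, one_mul, hw] at this
  have hz' := mul_le_mul_of_nonneg_left hz hB
  have hu : ((R + 1) / d) ^ 2 + (h / d) ^ 2 = 1 := by
    field_simp
    linarith
  have hμd' : μ ≤ (h + t * (R + 1)) / d := (le_div_iff₀ hd0).2 hμd
  rw [e1]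
  rcases le_total (h * A) (B * (R + 1)) with hcase | hcase
  · have hD : 0 < (R + 1) * S + h * c := by positivity
    have : μ ≤ t * A + 1 * B := by
      refine le_of_unit_combination (a₁ := (R + 1) / d) (b₁ := h / d) (a₂ := -c) (b₂ := S)
        (i := d * (S * A + c * B) / ((R + 1) * S + h * c))
        (j := (B * (R + 1) - h * A) / ((R + 1) * S + h * c)) hAB hu (by linarith) ?_ ?_ ?_ ?_
        hμ (hμd'.trans_eq (by field_simp; ring)) (by linarith)
      · positivity
      · exact div_nonneg (by linarith) hD.le
      · field_simp
        ring
      · field_simp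
        ring
    linarith
  · have hdR : R + 1 ≤ d := by nlinarith
    have : μ ≤ (h + t) * A + (-R) * B := by
      refine le_of_unit_combination (a₁ := 1) (b₁ := 0) (a₂ := (R + 1) / d) (b₂ := h / d)
        (i := A - B * (R + 1) / h) (j := B * d / h) hAB (by norm_num) hu ?_ (by positivity)
        (by field_simp; ring) (by field_simp; ring) hμ ?_ ?_
      · rw [sub_nonneg, div_le_iff₀ hh]
        linarith
      · refine hμd'.trans ?_
        rw [mul_one, mul_zero, add_zero, div_le_iff₀ hd0]
        nlinarith [mul_nonneg ht (sub_nonneg.2 hdR), mul_nonneg hh.le (sub_nonneg.2 hdR)]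
      · refine hμd'.trans_eq ?_
        field_simp
        ring
    linarith

/-- If the observation point projects into the disk, the disk condition alone forces A ≥ 0, which is
the dihedral condition of a right angle. -/
theorem AdmissibleNormal.of_norm_le_one {m : E} (hm : AdmissibleNormal e w h S c m)
    (hw : ‖w‖ ≤ 1) (hh : 0 < h) : AdmissibleNormal e w h 1 0 m := by
  obtain ⟨ν, A, B, hν, hνe, hB, hAB, hSA, hwm, rfl⟩ := hm
  refine ⟨ν, A, B, hν, hνe, hB, hAB, ?_, hwm, rfl⟩
  have : -1 ≤ ⟪ν, w⟫ := by
    have := (abs_le.1 (abs_real_inner_le_norm ν w)).1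
    rw [hν, one_mul] at this
    linarith
  have : 0 ≤ B * (1 + ⟪ν, w⟫) := mul_nonneg hB (by linarith)
  have : 0 ≤ A := by
    by_contra! hA
    nlinarith [mul_pos hh (neg_pos.2 hA)]
  linarith

end AdmissibleNormals

/-! ### Views in which one cap of radius 2δ suffices. -/

section FacetCounting

open InnerProductGeometry

variable {E : Type*} [NormedAddCommGroup E] [InnerProductSpace ℝ E]
  {e w : E} {h S c δ R d : ℝ} {V : Finset E} {K : Set E}

theorem norm_smul_add_sq (he : ‖e‖ = 1) (hwe : ⟪e, w⟫ = 0) (hw : ‖w‖ = R) (X : ℝ) :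
    ‖X • e + w‖ ^ 2 = X ^ 2 + R ^ 2 := by
  rw [norm_add_sq_real, real_inner_smul_left, hwe, norm_smul, he, hw, Real.norm_eq_abs, mul_one,
    sq_abs]
  ring

theorem smul_add_ne_zero (he : ‖e‖ = 1) (hwe : ⟪e, w⟫ = 0) {X : ℝ} (hX : 0 < X) :
    X • e + w ≠ 0 := by
  intro h0
  have : ⟪e, X • e + w⟫ = X := by
    rw [inner_add_right, real_inner_smul_right, hwe, real_inner_self_eq_norm_sq, he]
    ring
  rw [h0, inner_zero_right] at this
  exact hX.ne this

-- Turns a margin into a count: a direction that clears all admissible hyperplanes by the angle 2δ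
-- is the centre of a 2δ-cap inside `K`.
open Classical in
theorem finrank_le_card_of_margin [FiniteDimensional ℝ E] (hV : ∀ v ∈ V, ‖v‖ = 1)
    (hcov : ∀ u : E, ‖u‖ = 1 → ∃ v ∈ V, angle u v < δ) (hE : 2 ≤ Module.finrank ℝ E)
    (hδ0 : 0 < δ) (hδ : 6 * δ ≤ Real.pi / 2)
    (hK : ∀ v, ‖v‖ = 1 → (∀ m, AdmissibleNormal e w h S c m → 0 < ⟪v, m⟫) → v ∈ K)
    (he : ‖e‖ = 1) {U : E} (hU : U ≠ 0)
    (hm : ∀ m, AdmissibleNormal e w h S c m → Real.sin (2 * δ) * ‖U‖ ≤ ⟪U, m⟫) :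
    Module.finrank ℝ E ≤ (V.filter (· ∈ K)).card := by
  have hUn : 0 < ‖U‖ := norm_pos_iff.2 hU
  refine finrank_le_card_of_cap (u := ‖U‖⁻¹ • U) hV hcov hδ0 (by linarith [Real.pi_pos]) hE
    (by rw [norm_smul, norm_inv, norm_norm, inv_mul_cancel₀ hUn.ne']) fun v hv hang => ?_
  rw [angle_smul_left_of_pos _ _ (inv_pos.2 hUn)] at hang
  exact hK v hv fun m hadm => inner_pos_of_angle_lt hU (hadm.norm_eq_one he) (by linarith)
    (by linarith) (hm m hadm) hv hang

/-- Observation points whose projection lies in the disk. -/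
theorem exists_margin_of_norm_le_one (he : ‖e‖ = 1) (hwe : ⟪e, w⟫ = 0) (hw : ‖w‖ = R)
    (hh : 0 < h) (hS1 : S ≤ 1) (hδ0 : 0 < δ) (hδ : 6 * δ ≤ Real.pi / 2) (hd0 : 0 < d)
    (hd : d ^ 2 = h ^ 2 + (R + 1) ^ 2) (hsin : Real.sin (6 * δ) * d ≤ 2 * S) (hR : R ≤ 1) :
    ∃ U : E, U ≠ 0 ∧
      ∀ m, AdmissibleNormal e w h S c m → Real.sin (2 * δ) * ‖U‖ ≤ ⟪U, m⟫ := by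
  have hR0 : 0 ≤ R := hw ▸ norm_nonneg w
  -- Chosen so that ‖X e + w‖ = d. Margin 1 is then enough, since sin 2δ · d ≤ (1/2) sin 6δ · d ≤ S
  -- ≤ 1.
  set X := √(h ^ 2 + 1 + 2 * R) with hX
  have hX2 : X ^ 2 = h ^ 2 + 1 + 2 * R := Real.sq_sqrt (by positivity)
  have hX0 : 0 ≤ X := Real.sqrt_nonneg _
  have hhX : h < X := by nlinarith
  have hXd : X ≤ d := by nlinarith
  have hhd : h < d := by nlinarith
  have hn : ‖X • e + w‖ = d := by
    refine (pow_left_inj₀ (norm_nonneg _) hd0.le two_ne_zero).1 ?_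
    rw [norm_smul_add_sq he hwe hw, hX2, hd]
    ring
  refine ⟨X • e + w, smul_add_ne_zero he hwe (by linarith), fun m hm => ?_⟩
  rw [hn]
  have h1 := two_mul_sin_two_mul_le hδ hδ0
  have h2 : Real.sin (2 * δ) * d ≤ 1 := by nlinarith
  refine h2.trans ?_
  have hkey : 1 * d ≤ h + (X - h) * (R + 1) := by
    have e1 : (X - h) * (X + h) = 1 + 2 * R := by linear_combination hX2
    have e2 : (d - h) * (d + h) = (R + 1) ^ 2 := by linear_combination hd
    by_contra! hlt
    have a1 : (X - h) * (R + 1) * (d + h) < (R + 1) * (R + 1) := by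
      calc (X - h) * (R + 1) * (d + h) < (d - h) * (d + h) :=
            mul_lt_mul_of_pos_right (by linarith) (by linarith)
        _ = _ := by rw [e2]; ring
    have a2 : (1 + 2 * R) * (R + 1) ≤ (X - h) * (R + 1) * (d + h) := by
      rw [← e1]
      nlinarith [mul_nonneg (mul_nonneg (sub_nonneg.2 hhX.le) (by linarith : 0 ≤ R + 1))
        (sub_nonneg.2 hXd)]
    nlinarith
  have := (hm.of_norm_le_one (hw ▸ hR) hh).le_inner_of_disk (t := X - h) (μ := 1) he hwe hw hh
    one_pos le_rfl (by norm_num) hd0 hd (by linarith) zero_le_one hkey (by linarith)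
  rwa [add_sub_cancel] at this

/-- Observation points in the plane whose projection lies outside of the disk. -/
theorem exists_margin_of_finrank_eq_two [FiniteDimensional ℝ E] (hE : Module.finrank ℝ E = 2)
    (he : ‖e‖ = 1) (hwe : ⟪e, w⟫ = 0) (hw : ‖w‖ = R)
    (hh : 0 < h) (hS : 0 < S) (hc : 0 ≤ c) (hSc : S ^ 2 + c ^ 2 = 1) (hδ0 : 0 < δ)
    (hδ : 6 * δ ≤ Real.pi / 2) (hd0 : 0 < d)
    (hd : d ^ 2 = h ^ 2 + (R + 1) ^ 2) (hsin : Real.sin (6 * δ) * d ≤ 2 * S) (hR : 1 ≤ R) :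
    ∃ U : E, U ≠ 0 ∧
      ∀ m, AdmissibleNormal e w h S c m → Real.sin (2 * δ) * ‖U‖ ≤ ⟪U, m⟫ := by
  have hfr := finrank_orthogonal_span_singleton_add_one
    (norm_ne_zero_iff.1 (by rw [he]; exact one_ne_zero) : e ≠ 0)
  -- Measured from the projection of the observation point towards the disk, the near end of the
  -- facet lies at most R - 1 away because of the disk and at most h c / S away because of the
  -- dihedral angle.
  set v := min (h * c / S) (R - 1) with hv
  have hv0 : 0 ≤ v := le_min (by positivity) (by linarith)
  have hv1 : v * S ≤ h * c := by
    rw [← le_div_iff₀ hS]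
    exact min_le_left _ _
  have hv2 : v ≤ R - 1 := min_le_right _ _
  set d₂ := √(h ^ 2 + v ^ 2) with hd₂
  have hd₂2 : d₂ ^ 2 = h ^ 2 + v ^ 2 := Real.sq_sqrt (by positivity)
  have hd₂0 : 0 < d₂ := Real.sqrt_pos.2 (by positivity)
  have hd1 : 2 ≤ d := by nlinarith
  have hSd : S * d₂ ≤ h := by
    refine abs_le_of_sq_le_sq' ?_ hh.le |>.2
    have : (v * S) ^ 2 ≤ (h * c) ^ 2 := pow_le_pow_left₀ (by positivity) hv1 2
    rw [mul_pow, hd₂2]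
    nlinarith
  -- The sum of the unit vectors towards the far end R + 1 and the near end `v` bisects the angle
  -- under which that segment is seen. Its pairing with either extreme normal is the sine h (R + 1 -
  -- v) / (d d₂) of this angle, at least 2S / d, while its norm is at most 2.
  set X := h / d + h / d₂ with hX
  set Y := (R + 1) / d + v / d₂ with hY
  have hR0 : 0 < R := by linarith
  have hX0 : 0 < X := by positivity
  have hY0 : 0 ≤ Y := by positivity
  have hwe' : ⟪e, (Y / R) • w⟫ = 0 := by rw [real_inner_smul_right, hwe, mul_zero]
  have hw' : ‖(Y / R) • w‖ = Y := by
    rw [norm_smul, hw, Real.norm_of_nonneg (by positivity), div_mul_cancel₀ _ hR0.ne']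
  refine ⟨X • e + (Y / R) • w, smul_add_ne_zero he hwe' hX0, fun m hm => ?_⟩
  set γ := 2 * S / d with hγ
  have hu : ((R + 1) / d) ^ 2 + (h / d) ^ 2 = 1 := by
    field_simp
    linarith
  have hu₂ : (v / d₂) ^ 2 + (h / d₂) ^ 2 = 1 := by
    field_simp
    linarith
  have hn : ‖X • e + (Y / R) • w‖ ≤ 2 := by
    refine abs_le_of_sq_le_sq' ?_ (by norm_num) |>.2
    rw [norm_smul_add_sq he hwe' hw', hX, hY]
    linarith [sq_nonneg (h / d - h / d₂), sq_nonneg ((R + 1) / d - v / d₂)]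
  have hγ' : Real.sin (2 * δ) * ‖X • e + (Y / R) • w‖ ≤ γ := by
    have h1 := two_mul_sin_two_mul_le hδ hδ0
    have h2 : 0 ≤ Real.sin (2 * δ) :=
      Real.sin_nonneg_of_nonneg_of_le_pi (by linarith) (by linarith [Real.pi_pos])
    have h3 : Real.sin (6 * δ) ≤ γ := (le_div_iff₀ hd0).2 hsin
    linarith [mul_le_mul_of_nonneg_left hn h2]
  refine hγ'.trans ?_
  have hγ0 : 0 ≤ γ := by positivity
  have hSd' : S ≤ h / d₂ := (le_div_iff₀ hd₂0).2 hSd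
  have hγ1 : γ ≤ h / d₂ * ((R + 1) / d) - h / d * (v / d₂) := by
    have : γ ≤ h / d₂ * ((R + 1 - v) / d) := by
      rw [hγ, mul_div_assoc', div_le_div_iff_of_pos_right hd0]
      linarith [mul_le_mul hSd' (by linarith : 2 ≤ R + 1 - v) zero_le_two (by positivity)]
    refine this.trans_eq ?_
    ring
  have hγX : γ ≤ X := by
    have : γ ≤ S := by
      rw [hγ, div_le_iff₀ hd0]
      linarith [mul_le_mul_of_nonneg_left hd1 hS.le]
    have : 0 < h / d := by positivity
    linarith
  obtain ⟨ν, A, B, hν, hνe, hB, hAB, hSA, hwm, rfl⟩ := hm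
  have hν0 : ν ≠ 0 := norm_ne_zero_iff.1 (by rw [hν]; exact one_ne_zero)
  obtain ⟨q, hq⟩ : ∃ q : ℝ, q • ν = w := by
    have hmem : ∀ x : E, ⟪e, x⟫ = 0 → x ∈ (ℝ ∙ e)ᗮ := fun x hx =>
      Submodule.mem_orthogonal_singleton_iff_inner_right.2 hx
    obtain ⟨q, hq⟩ := exists_smul_eq_of_finrank_eq_one (by omega : Module.finrank ℝ (ℝ ∙ e)ᗮ = 1)
      (x := ⟨ν, hmem ν (by rw [real_inner_comm]; exact hνe)⟩)
      (fun h0 => hν0 (congrArg Subtype.val h0)) ⟨w, hmem w hwe⟩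
    exact ⟨q, congrArg Subtype.val hq⟩
  have hq1 : |q| = R := by rw [← hw, ← hq, norm_smul, hν, mul_one, Real.norm_eq_abs]
  have hνw : ⟪ν, w⟫ = q := by rw [← hq, real_inner_smul_right, real_inner_self_eq_norm_sq, hν]; ring
  have e1 : ⟪X • e + (Y / R) • w, A • e - B • ν⟫ = X * A - B * (Y / R * q) := by
    simp only [inner_add_left, inner_sub_right, real_inner_smul_left, real_inner_smul_right,
      real_inner_self_eq_norm_sq, he, real_inner_comm e w, hwe,
      real_inner_comm ν e, hνe, real_inner_comm ν w, hνw]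
    ring
  rw [e1]
  rw [hνw] at hwm
  rcases (abs_eq hR0.le).1 hq1 with rfl | rfl
  · rw [div_mul_cancel₀ _ hR0.ne']
    have : γ ≤ X * A + (-Y) * B := by
      refine le_of_unit_combination (a₁ := 1) (b₁ := 0) (a₂ := (q + 1) / d) (b₂ := h / d)
        (i := A - B * (q + 1) / h) (j := B * d / h) hAB (by norm_num) hu ?_ (by positivity)
        (by field_simp; ring) (by field_simp; ring) hγ0 (by linarith)
        (hγ1.trans_eq (by rw [hX, hY]; ring))
      rw [sub_nonneg, div_le_iff₀ hh]
      linarith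
    linarith
  · have hA : 0 ≤ h * A + B * v := by
      have a1 : 0 ≤ h * A + B * (h * c / S) := by
        have : h * A + B * (h * c / S) = h / S * (S * A + c * B) := by field_simp
        rw [this]
        positivity
      have a2 : 0 ≤ h * A + B * (R - 1) := by linarith
      rcases min_choice (h * c / S) (R - 1) with h' | h' <;> rw [hv, h'] <;> assumption
    have : γ ≤ X * A + Y * B := by
      refine le_of_unit_combination (a₁ := 1) (b₁ := 0) (a₂ := -(v / d₂)) (b₂ := h / d₂)
        (i := A + B * v / h) (j := B * d₂ / h) hAB (by norm_num) (by rw [neg_sq]; exact hu₂) ?_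
        (by positivity) (by field_simp; ring) (by field_simp; ring) hγ0 (by linarith)
        (hγ1.trans_eq (by rw [hX, hY]; ring))
      have : A + B * v / h = (h * A + B * v) / h := by field_simp
      rw [this]
      positivity
    have e2 : Y / R * -R = -Y := by field_simp
    rw [e2]
    linarith

/-- Observation points that see the facet under a steep angle. -/
theorem exists_margin_of_steep (he : ‖e‖ = 1) (hwe : ⟪e, w⟫ = 0) (hw : ‖w‖ = R)
    (hh : 0 < h) (hS : 0 < S) (hc : 0 ≤ c) (hSc : S ^ 2 + c ^ 2 = 1) (hδ0 : 0 < δ)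
    (hδ : 6 * δ ≤ Real.pi / 2) (hd0 : 0 < d)
    (hd : d ^ 2 = h ^ 2 + (R + 1) ^ 2) (hsin : Real.sin (6 * δ) * d ≤ 2 * S) (hR : 1 ≤ R)
    (hsteep : (2 / 3 * S * d - h) * c ≤ S / 3 * (R + 1)) :
    ∃ U : E, U ≠ 0 ∧
      ∀ m, AdmissibleNormal e w h S c m → Real.sin (2 * δ) * ‖U‖ ≤ ⟪U, m⟫ := by
  have hS1 : S ≤ 1 := by nlinarith
  -- The first two conditions after t ≥ 0 give the margin (2/3) S in
  -- `AdmissibleNormal.le_inner_of_disk`; the last one is the norm bound matching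
  -- `nine_mul_sin_two_mul_sq_le`. The least admissible t is taken, and steepness is what makes it
  -- satisfy t c ≤ S / 3.
  obtain ⟨t, ht0, ht1, ht2, ht3⟩ : ∃ t : ℝ, 0 ≤ t ∧ 2 / 3 * S * d ≤ h + t * (R + 1) ∧
      t * c ≤ S / 3 ∧ (h + t) ^ 2 + R ^ 2 + 20 / 9 * S ^ 2 ≤ d ^ 2 := by
    rcases le_total (2 / 3 * S * d) h with h1 | h1
    · exact ⟨0, le_rfl, by linarith, by linarith, by nlinarith⟩
    · refine ⟨(2 / 3 * S * d - h) / (R + 1), div_nonneg (by linarith) (by linarith), ?_, ?_, ?_⟩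
      · rw [div_mul_cancel₀ _ (by linarith)]
        linarith
      · rw [div_mul_eq_mul_div, div_le_iff₀ (by linarith)]
        exact hsteep
      · set t := (2 / 3 * S * d - h) / (R + 1) with ht
        set η := h / (R + 1) with hη
        have hQ : 0 < R + 1 := by linarith
        have et : t * (R + 1) = 2 / 3 * S * d - h := div_mul_cancel₀ _ hQ.ne'
        have eη : η * (R + 1) = h := div_mul_cancel₀ _ hQ.ne'
        have ht0 : 0 ≤ t := div_nonneg (by linarith) hQ.le
        have hη0 : 0 ≤ η := by positivity
        have hsum : (t + η) ^ 2 = 4 / 9 * S ^ 2 * (1 + η ^ 2) := by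
          have h2 : (R + 1) ^ 2 * ((t + η) ^ 2 - 4 / 9 * S ^ 2 * (1 + η ^ 2)) = 0 := by
            have : (R + 1) ^ 2 * ((t + η) ^ 2 - 4 / 9 * S ^ 2 * (1 + η ^ 2)) =
                (t * (R + 1) + η * (R + 1)) ^ 2
                  - 4 / 9 * S ^ 2 * ((R + 1) ^ 2 + (η * (R + 1)) ^ 2) := by ring
            rw [this, et, eη]
            linear_combination 4 / 9 * S ^ 2 * hd
          rcases mul_eq_zero.1 h2 with h3 | h3
          · exact absurd h3 (by positivity)
          · linarith
        have hS2 : S ^ 2 ≤ 1 := by nlinarith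
        have hηt : η * t ≤ 2 / 15 := by
          linarith [sq_nonneg (t - 2 / 3 * η), mul_nonneg (sub_nonneg.2 hS2) (sq_nonneg η),
            sq_nonneg η]
        have hfin : 4 * (η * t) + t ^ 2 + 20 / 9 * S ^ 2 ≤ 3 := by
          linarith [mul_nonneg (sub_nonneg.2 hS2) (sq_nonneg η), sq_nonneg η]
        have e3 : h * t = η * t * (R + 1) := by rw [← eη]; ring
        have e4 := mul_le_mul_of_nonneg_right hηt (sub_nonneg.2 hR)
        rw [hd]
        linarith
  refine ⟨(h + t) • e + w, smul_add_ne_zero he hwe (by linarith), fun m hm => ?_⟩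
  have hmain : Real.sin (2 * δ) * ‖(h + t) • e + w‖ ≤ 2 / 3 * S := by
    refine abs_le_of_sq_le_sq' ?_ (by positivity) |>.2
    rw [mul_pow, norm_smul_add_sq he hwe hw]
    have h1 := nine_mul_sin_two_mul_sq_le hδ hδ0
    have h2 : 0 ≤ Real.sin (6 * δ) :=
      Real.sin_nonneg_of_nonneg_of_le_pi (by linarith) (by linarith [Real.pi_pos])
    have h3 : (Real.sin (6 * δ) * d) ^ 2 ≤ (2 * S) ^ 2 :=
      pow_le_pow_left₀ (by positivity) hsin 2
    set y := Real.sin (2 * δ) ^ 2 with hy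
    have hy0 : 0 ≤ y := sq_nonneg _
    have h4 := mul_le_mul_of_nonneg_right h1 (sq_nonneg d)
    have h5 := mul_le_mul_of_nonneg_right h3 (by linarith : (0 : ℝ) ≤ 1 + 5 * y)
    nlinarith [mul_le_mul_of_nonneg_left ht3 hy0]
  exact hmain.trans (hm.le_inner_of_disk he hwe hw hh hS hc hSc hd0 hd ht0 (by positivity)
    (by linarith) (by linarith))

end FacetCounting

/-! ### Flat views: a cap surrounded by a ring of caps. -/

section FacetCountingFlat

open InnerProductGeometry

theorem le_one_of_sq_add_sq_eq_one {x y : ℝ} (h : x ^ 2 + y ^ 2 = 1) : x ≤ 1 := by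
  nlinarith [sq_nonneg y]

theorem two_le_of_sq_eq {h R d : ℝ} (hd0 : 0 < d) (hd : d ^ 2 = h ^ 2 + (R + 1) ^ 2) (hR : 1 ≤ R) :
    2 ≤ d := by
  nlinarith [sq_nonneg h]

/-- The crude bound d ≤ R + 1 + h first gives c > 1/2 and h ≤ R + 1, which permits the sharper d ≤ R
+ 1 + h/2. Then h / (R + 1) < S (2c - 1) / (c (3 - S)), and this quotient stays below 0.196 on the
circle. -/
theorem height_le_of_flat {h S c R d : ℝ} (hh : 0 < h) (hS : 0 < S) (hc : 0 ≤ c)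
    (hSc : S ^ 2 + c ^ 2 = 1) (hd0 : 0 < d) (hd : d ^ 2 = h ^ 2 + (R + 1) ^ 2) (hR : 1 ≤ R)
    (hflat : S / 3 * (R + 1) < (2 / 3 * S * d - h) * c) :
    1 / 2 < c ∧ h ≤ 0.196 * (R + 1) := by
  have hS1 : S ≤ 1 := by nlinarith
  have hc1 : c ≤ 1 := by nlinarith
  have hSc0 : 0 ≤ S * c := mul_nonneg hS.le hc
  have hQ : 0 < R + 1 := by linarith
  have hd1 : d ≤ R + 1 + h := by nlinarith
  have h1 : h * c * (3 - 2 * S) < S * (2 * c - 1) * (R + 1) := by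
    nlinarith [mul_le_mul_of_nonneg_left hd1 hSc0]
  have hc2 : 1 / 2 < c := by
    by_contra! hle
    have a1 : 0 ≤ h * c * (3 - 2 * S) := by
      have : 0 ≤ 3 - 2 * S := by linarith
      positivity
    have a2 : 0 ≤ S * (1 - 2 * c) * (R + 1) := by
      have : 0 ≤ 1 - 2 * c := by linarith
      positivity
    linarith
  have hc0 : 0 < c := by linarith
  refine ⟨hc2, ?_⟩
  have h2 : h ≤ R + 1 := by
    by_contra! hlt
    have a1 : (R + 1) * c * 1 ≤ h * c * (3 - 2 * S) :=
      mul_le_mul (mul_le_mul_of_nonneg_right hlt.le hc) (by linarith) zero_le_one (by positivity)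
    have a2 : S * (2 * c - 1) * (R + 1) ≤ c * (R + 1) := by
      refine mul_le_mul_of_nonneg_right ?_ hQ.le
      nlinarith
    linarith
  have hd2 : d ≤ R + 1 + h / 2 := by nlinarith
  have h3 : h * c * (3 - S) < S * (2 * c - 1) * (R + 1) := by
    nlinarith [mul_le_mul_of_nonneg_left hd2 hSc0]
  have h4 : S * (2 * c - 1) ≤ 0.196 * (c * (3 - S)) := by
    have a1 : S * 1.252 ≤ 1.392 - c ^ 2 := by nlinarith [sq_nonneg (S - 0.626)]
    have a2 : (1.392 - c ^ 2) * (2.196 * c - 1) ≤ 0.736 * c := by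
      nlinarith [mul_nonneg hc (sq_nonneg (c - 0.764)), sq_nonneg (c - 0.764)]
    have a3 := mul_le_mul_of_nonneg_right a1 (by linarith : 0 ≤ 2.196 * c - 1)
    nlinarith
  by_contra! hlt
  have h5 : 0 < c * (3 - S) := mul_pos hc0 (by linarith)
  have h6 := mul_lt_mul_of_pos_right hlt h5
  have h7 := mul_le_mul_of_nonneg_right h4 hQ.le
  linarith

/-- Provides the central cap of the flat case. The first two conditions give its axis the margin S /
3, the third is the norm bound for a δ-cap, and the last, a bound on a Gram determinant, keeps it 2δ
away from the ring. -/
theorem exists_apex_height {h S c R d : ℝ} (hh : 0 < h) (hS : 0 < S)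
    (hSc : S ^ 2 + c ^ 2 = 1) (hd : d ^ 2 = h ^ 2 + (R + 1) ^ 2) (hR : 1 ≤ R)
    (hc : 1 / 2 < c) (hhR : h ≤ 0.196 * (R + 1)) :
    ∃ t : ℝ, S / 3 ≤ t ∧ t * c ≤ 2 / 3 * S ∧ (h + t) ^ 2 + R ^ 2 + 2 * S ^ 2 ≤ d ^ 2 ∧
      4 / 9 * S ^ 2 * ((h + t) ^ 2 + R ^ 2) ≤
        R ^ 2 * (t - S / 3) ^ 2 + ((2 - c) / 3) ^ 2 * ((h + t) ^ 2 + R ^ 2) := by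
  have hS2 : S ^ 2 ≤ 3 / 4 := by nlinarith
  have hS1 : S ≤ 0.8661 := by nlinarith
  have hc1 : c ≤ 1 := by nlinarith
  -- Up to c = 4/5 the height (5/6) S respects t c ≤ (2/3) S, and (2 - c)² = 3S² + (2c - 1)² helps
  -- with the last bound. From c = 4/5 on, 2S ≤ 2 - c holds and the ring radius alone gives that
  -- bound.
  rcases le_total c 0.8 with hc8 | hc8
  · refine ⟨5 / 6 * S, by linarith, by nlinarith, ?_, ?_⟩
    · rw [hd]
      have : h * S ≤ 0.196 * (R + 1) * 0.8661 := mul_le_mul hhR hS1 hS.le (by linarith)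
      nlinarith
    · have a1 : h + 5 / 6 * S ≤ 1.115 * R := by linarith
      have a2 : (h + 5 / 6 * S) ^ 2 + R ^ 2 ≤ 9 / 4 * R ^ 2 := by
        have := pow_le_pow_left₀ (by positivity) a1 2
        rw [mul_pow] at this
        nlinarith [sq_nonneg R]
      set X := (h + 5 / 6 * S) ^ 2 + R ^ 2
      have hX : 0 ≤ X := by positivity
      have a3 : 0 ≤ (2 * c - 1) ^ 2 * X := by positivity
      have a4 := mul_le_mul_of_nonneg_right a2 (sq_nonneg S)
      have hc2 : c ^ 2 = 1 - S ^ 2 := by linarith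
      have a5 : (2 - c) ^ 2 * X = 3 * S ^ 2 * X + (2 * c - 1) ^ 2 * X := by
        linear_combination -3 * X * hc2
      have a6 : (5 / 6 * S - S / 3) ^ 2 = S ^ 2 / 4 := by ring
      rw [a6]
      linarith
  · have hS6 : S ≤ 0.6 := by nlinarith
    refine ⟨2 / 3 * S, by linarith, by nlinarith, ?_, ?_⟩
    · rw [hd]
      have : h * S ≤ 0.196 * (R + 1) * 0.8661 := mul_le_mul hhR hS1 hS.le (by linarith)
      nlinarith
    · set X := (h + 2 / 3 * S) ^ 2 + R ^ 2
      have hX : 0 ≤ X := by positivity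
      have a1 : 4 / 9 * S ^ 2 ≤ ((2 - c) / 3) ^ 2 := by nlinarith
      have a2 := mul_le_mul_of_nonneg_right a1 hX
      have a3 : 0 ≤ R ^ 2 * (2 / 3 * S - S / 3) ^ 2 := by positivity
      linarith

theorem base_norm_sq_le {h S c R d : ℝ} (hh : 0 < h) (hS : 0 < S)
    (hSc : S ^ 2 + c ^ 2 = 1) (hd : d ^ 2 = h ^ 2 + (R + 1) ^ 2) (hR : 1 ≤ R)
    (hc : 1 / 2 < c) (hhR : h ≤ 0.196 * (R + 1)) :
    (h + S / 3) ^ 2 + R ^ 2 + ((2 - c) / 3) ^ 2 + 2 * S ^ 2 ≤ d ^ 2 := by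
  have hS2 : S ^ 2 ≤ 3 / 4 := by nlinarith
  have hS1 : S ≤ 0.8661 := by nlinarith
  have : h * S ≤ 0.196 * (R + 1) * 0.8661 := mul_le_mul hhR hS1 hS.le (by linarith)
  rw [hd]
  nlinarith

/-- A margin of S / 3 leaves room for a δ-cap. As d ≥ 2, sin 6δ ≤ S, which supplies the hypothesis
of `thirtysix_mul_sin_sq_le`. -/
theorem sin_mul_norm_le {E : Type*} [NormedAddCommGroup E] {U : E} {S d δ : ℝ} (hS : 0 < S)
    (hS2 : S ^ 2 ≤ 3 / 4) (hd2 : 2 ≤ d) (hδ0 : 0 < δ) (hδ : 6 * δ ≤ Real.pi / 2)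
    (hsin : Real.sin (6 * δ) * d ≤ 2 * S) (hU : ‖U‖ ^ 2 + 2 * S ^ 2 ≤ d ^ 2) :
    Real.sin δ * ‖U‖ ≤ S / 3 := by
  have h2 : 0 ≤ Real.sin (6 * δ) :=
    Real.sin_nonneg_of_nonneg_of_le_pi (by linarith) (by linarith [Real.pi_pos])
  have h3 : (Real.sin (6 * δ) * d) ^ 2 ≤ (2 * S) ^ 2 :=
    pow_le_pow_left₀ (by positivity) hsin 2
  have h1 := thirtysix_mul_sin_sq_le hδ hδ0 (by
    have : Real.sin (6 * δ) ≤ S := by nlinarith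
    nlinarith)
  refine abs_le_of_sq_le_sq' ?_ (by positivity) |>.2
  rw [mul_pow]
  set y := Real.sin δ ^ 2 with hy
  have hy0 : 0 ≤ y := sq_nonneg _
  have h4 := mul_le_mul_of_nonneg_right h1 (sq_nonneg d)
  have h5 := mul_le_mul_of_nonneg_right h3 (by linarith : (0 : ℝ) ≤ 1 + 18 * y)
  nlinarith [mul_le_mul_of_nonneg_left hU hy0]

variable {E : Type*} [NormedAddCommGroup E] [InnerProductSpace ℝ E] [FiniteDimensional ℝ E]
  {e w : E} {h S c δ R d : ℝ} {V : Finset E} {K : Set E}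

theorem finrank_orthogonal_span_pair (e w : E) :
    Module.finrank ℝ E ≤ Module.finrank ℝ (Submodule.span ℝ {e, w})ᗮ + 2 := by
  have h1 := Submodule.finrank_add_finrank_orthogonal (Submodule.span ℝ ({e, w} : Set E))
  have h2 : Module.finrank ℝ (Submodule.span ℝ ({e, w} : Set E)) ≤ 2 := by
    classical
    have := finrank_span_finset_le_card (R := ℝ) ({e, w} : Finset E)
    rw [Finset.coe_insert, Finset.coe_singleton] at this
    exact this.trans Finset.card_le_two
  omega

open Classical in
/-- Observation points that see the facet under a flat angle. -/
theorem finrank_le_card_of_flat (hV : ∀ v ∈ V, ‖v‖ = 1)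
    (hcov : ∀ u : E, ‖u‖ = 1 → ∃ v ∈ V, angle u v < δ) (hE : 3 ≤ Module.finrank ℝ E)
    (hK : ∀ v, ‖v‖ = 1 → (∀ m, AdmissibleNormal e w h S c m → 0 < ⟪v, m⟫) → v ∈ K)
    (he : ‖e‖ = 1) (hwe : ⟪e, w⟫ = 0) (hw : ‖w‖ = R)
    (hh : 0 < h) (hS : 0 < S) (hc : 0 ≤ c) (hSc : S ^ 2 + c ^ 2 = 1) (hδ0 : 0 < δ)
    (hδ : 6 * δ ≤ Real.pi / 2) (hd0 : 0 < d)
    (hd : d ^ 2 = h ^ 2 + (R + 1) ^ 2) (hsin : Real.sin (6 * δ) * d ≤ 2 * S) (hR : 1 ≤ R)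
    (hflat : S / 3 * (R + 1) < (2 / 3 * S * d - h) * c) :
    Module.finrank ℝ E ≤ (V.filter (· ∈ K)).card := by
  obtain ⟨hc2, hhR⟩ := height_le_of_flat hh hS hc hSc hd0 hd hR hflat
  obtain ⟨t, ht1, ht2, ht3, ht4⟩ := exists_apex_height hh hS hSc hd hR hc2 hhR
  have hbase := base_norm_sq_le hh hS hSc hd hR hc2 hhR
  have hπ := Real.pi_pos
  have hS2 : S ^ 2 ≤ 3 / 4 := by
    have := pow_le_pow_left₀ (by norm_num) hc2.le 2
    linarith
  have hS1 : S ≤ 1 := le_one_of_sq_add_sq_eq_one hSc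
  have hc1 : c ≤ 1 := le_one_of_sq_add_sq_eq_one (y := S) (by linarith)
  have hd2 : 2 ≤ d := two_le_of_sq_eq hd0 hd hR
  -- The ring radius for which the endpoint value (1 - g) S - (S/3) c in `AdmissibleNormal.le_inner`
  -- equals S / 3, the value at the other endpoint.
  set g := (2 - c) / 3 with hg
  have hg0 : 0 ≤ g := by rw [hg]; linarith
  set W := (Submodule.span ℝ ({e, w} : Set E))ᗮ with hW
  have hWe : ∀ σ ∈ W, ⟪e, σ⟫ = 0 := fun σ hσ =>
    (Submodule.mem_orthogonal _ _).1 hσ e (Submodule.subset_span (by simp))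
  have hWw : ∀ σ ∈ W, ⟪w, σ⟫ = 0 := fun σ hσ =>
    (Submodule.mem_orthogonal _ _).1 hσ w (Submodule.subset_span (by simp))
  have hWfr : Module.finrank ℝ E ≤ Module.finrank ℝ W + 2 := finrank_orthogonal_span_pair e w
  have hW0 : 0 < Module.finrank ℝ W := by omega
  set a := (h + t) • e + w with ha
  set b := (h + S / 3) • e + w with hb
  have hbσ : ∀ σ ∈ W, ⟪b, σ⟫ = 0 := fun σ hσ => by
    rw [hb, inner_add_left, real_inner_smul_left, hWe σ hσ, hWw σ hσ]
    ring
  have haσ : ∀ σ ∈ W, ⟪a, σ⟫ = 0 := fun σ hσ => by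
    rw [ha, inner_add_left, real_inner_smul_left, hWe σ hσ, hWw σ hσ]
    ring
  have han : ‖a‖ ^ 2 = (h + t) ^ 2 + R ^ 2 := norm_smul_add_sq he hwe hw _
  have hbn : ‖b‖ ^ 2 = (h + S / 3) ^ 2 + R ^ 2 := norm_smul_add_sq he hwe hw _
  have hpn : ∀ σ ∈ W, ‖σ‖ = 1 → ‖b + g • σ‖ ^ 2 = ‖b‖ ^ 2 + g ^ 2 := fun σ hσW hσ => by
    rw [norm_add_sq_real, real_inner_smul_right, hbσ σ hσW, norm_smul, hσ, Real.norm_eq_abs,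
      mul_one, sq_abs]
    ring
  have ha0 : a ≠ 0 := smul_add_ne_zero he hwe (by linarith)
  have hb0 : b ≠ 0 := smul_add_ne_zero he hwe (by linarith)
  have hp0 : ∀ σ ∈ W, ‖σ‖ = 1 → b + g • σ ≠ 0 := fun σ hσW hσ h0 => by
    have h1 := hpn σ hσW hσ
    rw [h0, norm_zero] at h1
    have : 0 < ‖b‖ ^ 2 := by have := norm_pos_iff.2 hb0; positivity
    linarith [sq_nonneg g]
  have hma : Real.sin δ * ‖a‖ ≤ S / 3 := sin_mul_norm_le hS hS2 hd2 hδ0 hδ hsin (by rw [han]; linarith)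
  have hmp : ∀ σ ∈ W, ‖σ‖ = 1 → Real.sin δ * ‖b + g • σ‖ ≤ S / 3 := fun σ hσW hσ =>
    sin_mul_norm_le hS hS2 hd2 hδ0 hδ hsin (by rw [hpn σ hσW hσ, hbn]; linarith)
  have hsδ : 0 ≤ Real.sin δ := Real.sin_nonneg_of_nonneg_of_le_pi hδ0.le (by linarith)
  obtain ⟨σ₀, hσ₀W, hσ₀, -⟩ := exists_unit_inner_nonpos W ∅ (by simp) hW0
  refine finrank_le_card_of_cap_of_rim (a := a) (b := b) (g := g) (W := W) hV hcov hδ0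
    (by linarith) hWfr hW0 hg0 ?_ ?_ ha0 hb0 hbσ ?_ ?_
  · intro v hv hav
    refine hK v hv fun m hm => inner_pos_of_angle_lt ha0 (hm.norm_eq_one he) hδ0.le (by linarith)
      (hma.trans ?_) hv hav
    have := hm.le_inner (z := 0) (t := t) (g := 0) (μ := S / 3) he hwe (inner_zero_right _)
      norm_zero.le hS hSc (by positivity) ht1 (by linarith)
    rwa [add_zero] at this
  · intro σ hσW hσ v hv hbv
    refine hK v hv fun m hm => inner_pos_of_angle_lt (hp0 σ hσW hσ) (hm.norm_eq_one he) hδ0.le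
      (by linarith) ((hmp σ hσW hσ).trans ?_) hv hbv
    refine hm.le_inner (z := g • σ) (t := S / 3) (g := g) (μ := S / 3) he hwe ?_ ?_ hS hSc
      (by positivity) le_rfl (by rw [hg]; linarith)
    · rw [real_inner_smul_right, hWe σ hσW, mul_zero]
    · rw [norm_smul, hσ, Real.norm_of_nonneg hg0, mul_one]
  · have h1 := hmp σ₀ hσ₀W hσ₀
    have h2 : (Real.sin δ * ‖b + g • σ₀‖) ^ 2 ≤ g ^ 2 :=
      pow_le_pow_left₀ (by positivity) (h1.trans (by rw [hg]; linarith)) 2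
    rwa [mul_pow, hpn σ₀ hσ₀W hσ₀] at h2
  · intro σ hσW hσ
    have hcos : 0 ≤ Real.cos (2 * δ) := Real.cos_nonneg_of_mem_Icc ⟨by linarith, by linarith⟩
    refine abs_le_of_sq_le_sq' ?_ (by positivity) |>.2
    have e1 : ⟪a, b + g • σ⟫ = (h + t) * (h + S / 3) + R ^ 2 := by
      rw [inner_add_right, real_inner_smul_right, haσ σ hσW, ha, hb, inner_add_left,
        inner_add_right, inner_add_right, real_inner_smul_left, real_inner_smul_left,
        real_inner_smul_right, real_inner_smul_right, real_inner_comm e w, hwe,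
        real_inner_self_eq_norm_sq, real_inner_self_eq_norm_sq, he, hw]
      ring
    have h1 : Real.sin (2 * δ) * ‖b + g • σ‖ ≤ 2 / 3 * S := by
      have := mul_le_mul_of_nonneg_right (sin_two_mul_le_two_mul_sin hδ hδ0)
        (norm_nonneg (b + g • σ))
      linarith [hmp σ hσW hσ]
    have hs2 : 0 ≤ Real.sin (2 * δ) :=
      Real.sin_nonneg_of_nonneg_of_le_pi (by linarith) (by linarith)
    have h2 := pow_le_pow_left₀ (by positivity) h1 2
    have h3 := mul_le_mul_of_nonneg_right h2 (sq_nonneg ‖a‖)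
    have h4 := Real.sin_sq_add_cos_sq (2 * δ)
    have h5 : Real.cos (2 * δ) ^ 2 = 1 - Real.sin (2 * δ) ^ 2 := by linarith
    rw [e1, mul_pow, mul_pow, h5]
    rw [mul_pow, mul_pow] at h3
    -- The Gram determinant of `a` and a ring point. It dominates ((2/3) S ‖a‖)², hence (sin 2δ ·
    -- ‖a‖ ‖b + g σ‖)², which separates the two by the angle 2δ.
    have h6 : ‖a‖ ^ 2 * ‖b + g • σ‖ ^ 2 - ((h + t) * (h + S / 3) + R ^ 2) ^ 2
        = R ^ 2 * (t - S / 3) ^ 2 + g ^ 2 * ((h + t) ^ 2 + R ^ 2) := by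
      rw [hpn σ hσW hσ, han, hbn]
      ring
    rw [← han] at h6 ht4
    linarith

open Classical in
/-- A facet containing a disk is seen from a point in at least `dim E` directions of a dense
enough set of directions. -/
theorem finrank_le_card_of_admissible (hV : ∀ v ∈ V, ‖v‖ = 1)
    (hcov : ∀ u : E, ‖u‖ = 1 → ∃ v ∈ V, angle u v < δ) (hE : 2 ≤ Module.finrank ℝ E)
    (hK : ∀ v, ‖v‖ = 1 → (∀ m, AdmissibleNormal e w h S c m → 0 < ⟪v, m⟫) → v ∈ K)
    (he : ‖e‖ = 1) (hwe : ⟪e, w⟫ = 0) (hw : ‖w‖ = R)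
    (hh : 0 < h) (hS : 0 < S) (hc : 0 ≤ c) (hSc : S ^ 2 + c ^ 2 = 1) (hδ0 : 0 < δ)
    (hδ : 6 * δ ≤ Real.pi / 2) (hd0 : 0 < d)
    (hd : d ^ 2 = h ^ 2 + (R + 1) ^ 2) (hsin : Real.sin (6 * δ) * d ≤ 2 * S) :
    Module.finrank ℝ E ≤ (V.filter (· ∈ K)).card := by
  rcases le_total R 1 with hR | hR
  · obtain ⟨U, hU, hm⟩ := exists_margin_of_norm_le_one (c := c) he hwe hw hh (le_one_of_sq_add_sq_eq_one hSc) hδ0 hδ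
      hd0 hd hsin hR
    exact finrank_le_card_of_margin hV hcov hE hδ0 hδ hK he hU hm
  rcases hE.lt_or_eq with hE3 | hE2
  · rcases le_or_gt ((2 / 3 * S * d - h) * c) (S / 3 * (R + 1)) with hst | hfl
    · obtain ⟨U, hU, hm⟩ := exists_margin_of_steep he hwe hw hh hS hc hSc hδ0 hδ hd0 hd hsin hR hst
      exact finrank_le_card_of_margin hV hcov hE hδ0 hδ hK he hU hm
    · exact finrank_le_card_of_flat hV hcov hE3 hK he hwe hw hh hS hc hSc hδ0 hδ hd0 hd hsin hR hfl
  · obtain ⟨U, hU, hm⟩ := exists_margin_of_finrank_eq_two hE2.symm he hwe hw hh hS hc hSc hδ0 hδ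
      hd0 hd hsin hR
    exact finrank_le_card_of_margin hV hcov hE hδ0 hδ hK he hU hm

end FacetCountingFlat

/-! ### Volume bound for packings of caps, and maximal separated sets. -/

section SphericalPacking

open InnerProductGeometry MeasureTheory

/-- The open circular sector of the unit ball with axis `u` and half-angle `φ`. -/
def ballSector {E : Type*} [NormedAddCommGroup E] [InnerProductSpace ℝ E] (u : E) (φ : ℝ) : Set E :=
  {y | ‖y‖ < 1 ∧ Real.cos φ * ‖y‖ < ⟪u, y⟫}

theorem isOpen_ballSector {E : Type*} [NormedAddCommGroup E] [InnerProductSpace ℝ E] (u : E)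
    (φ : ℝ) : IsOpen (ballSector u φ) :=
  (isOpen_lt continuous_norm continuous_const).inter
    (isOpen_lt (continuous_const.mul continuous_norm) (continuous_const.inner continuous_id))

theorem disjoint_ballSector {E : Type*} [NormedAddCommGroup E] [InnerProductSpace ℝ E] {u v : E}
    {φ : ℝ} (hφ0 : 0 ≤ φ) (hφ : φ ≤ Real.pi) (hu : ‖u‖ = 1) (hv : ‖v‖ = 1)
    (huv : 2 * φ ≤ angle u v) : Disjoint (ballSector u φ) (ballSector v φ) := by
  have key : ∀ {u y : E}, ‖u‖ = 1 → y ∈ ballSector u φ → angle u y < φ := by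
    intro u y hu hy
    have hy0 : 0 < ‖y‖ := by
      refine norm_pos_iff.2 fun h0 => ?_
      have := hy.2
      rw [h0, norm_zero, inner_zero_right, mul_zero] at this
      exact lt_irrefl _ this
    rw [angle, hu, one_mul]
    by_contra! hle
    have h1 := Real.strictAntiOn_cos.antitoneOn ⟨hφ0, hφ⟩
      ⟨Real.arccos_nonneg _, Real.arccos_le_pi _⟩ hle
    have h2 := abs_le.1 (abs_real_inner_le_norm u y)
    rw [hu, one_mul] at h2
    rw [Real.cos_arccos (by rw [le_div_iff₀ hy0]; linarith) (by rw [div_le_iff₀ hy0]; linarith),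
      div_le_iff₀ hy0] at h1
    linarith [hy.2]
  rw [Set.disjoint_left]
  intro y hyu hyv
  have h1 := key hu hyu
  have h2 := key hv hyv
  have h3 := angle_le_angle_add_angle u y v
  rw [angle_comm y v] at h3
  linarith

theorem volume_ballSector_eq {n : ℕ} {u v : EuclideanSpace ℝ (Fin n)} (hu : ‖u‖ = 1) (hv : ‖v‖ = 1)
    (φ : ℝ) : volume (ballSector u φ) = volume (ballSector v φ) := by
  set f := (ℝ ∙ (u - v))ᗮ.reflection with hf
  have hfu : f u = v := Submodule.reflection_sub (hu.trans hv.symm)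
  have hpre : f ⁻¹' ballSector v φ = ballSector u φ := by
    ext y
    rw [Set.mem_preimage, ballSector, ballSector, Set.mem_ofPred_eq, Set.mem_ofPred_eq,
      LinearIsometryEquiv.norm_map, ← hfu, LinearIsometryEquiv.inner_map_map]
  rw [← hpre]
  exact f.measurePreserving.measure_preimage (isOpen_ballSector v φ).measurableSet.nullMeasurableSet

/-- The volume of the unit ball of `ℝⁿ`. -/
noncomputable def unitBallVolume (n : ℕ) : ℝ := √Real.pi ^ n / Real.Gamma (n / 2 + 1)

theorem unitBallVolume_pos (n : ℕ) : 0 < unitBallVolume n :=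
  div_pos (pow_pos (Real.sqrt_pos.2 Real.pi_pos) n) (Real.Gamma_pos_of_pos (by positivity))

theorem volume_ball_zero {n : ℕ} (hn : 0 < n) (r : ℝ) :
    volume (Metric.ball (0 : EuclideanSpace ℝ (Fin n)) r) =
      ENNReal.ofReal r ^ n * ENNReal.ofReal (unitBallVolume n) := by
  have : Nonempty (Fin n) := ⟨⟨0, hn⟩⟩
  rw [EuclideanSpace.volume_ball, Fintype.card_fin, unitBallVolume]

/-- The measurable equivalence that splits off the first coordinate. -/
noncomputable def splitFirst (n : ℕ) :
    EuclideanSpace ℝ (Fin (n + 1)) ≃ᵐ ℝ × EuclideanSpace ℝ (Fin n) :=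
  ((MeasurableEquiv.toLp 2 (Fin (n + 1) → ℝ)).symm.trans
    (MeasurableEquiv.piFinSuccAbove (fun _ => ℝ) 0)).trans
    ((MeasurableEquiv.refl ℝ).prodCongr (MeasurableEquiv.toLp 2 (Fin n → ℝ)))

theorem measurePreserving_splitFirst (n : ℕ) : MeasurePreserving (splitFirst n) := by
  refine MeasurePreserving.trans (MeasurePreserving.trans
    (EuclideanSpace.volume_preserving_symm_measurableEquiv_toLp _)
    (volume_preserving_piFinSuccAbove (fun _ => ℝ) 0)) ?_
  exact (MeasurePreserving.id volume).prod (PiLp.volume_preserving_toLp (Fin n))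

theorem splitFirst_fst {n : ℕ} (y : EuclideanSpace ℝ (Fin (n + 1))) : (splitFirst n y).1 = y 0 := rfl

theorem norm_sq_splitFirst {n : ℕ} (y : EuclideanSpace ℝ (Fin (n + 1))) :
    ‖y‖ ^ 2 = (splitFirst n y).1 ^ 2 + ‖(splitFirst n y).2‖ ^ 2 := by
  rw [EuclideanSpace.real_norm_sq_eq, EuclideanSpace.real_norm_sq_eq, Fin.sum_univ_succ]
  rfl

/-- Integrates the cross sections of a double cone of total height 1 over a base of radius s; the
position c of the base drops out. -/
theorem integral_min_pow {s c : ℝ} (n : ℕ) (hs : 0 < s) (hc0 : 0 < c) (hc1 : c < 1) :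
    ∫ t in (0 : ℝ)..1, (min (t * (s / c)) ((1 - t) * (s / (1 - c)))) ^ n = s ^ n / (n + 1) := by
  have hcont : Continuous fun t : ℝ => (min (t * (s / c)) ((1 - t) * (s / (1 - c)))) ^ n := by
    fun_prop
  have h1c : 0 < 1 - c := by linarith
  have hn : (n : ℝ) + 1 ≠ 0 := by positivity
  rw [← intervalIntegral.integral_add_adjacent_intervals (b := c)
    (hcont.intervalIntegrable _ _) (hcont.intervalIntegrable _ _)]
  have e1 : ∫ t in (0 : ℝ)..c, (min (t * (s / c)) ((1 - t) * (s / (1 - c)))) ^ n =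
      ∫ t in (0 : ℝ)..c, t ^ n * (s / c) ^ n := by
    refine intervalIntegral.integral_congr fun t ht => ?_
    rw [Set.uIcc_of_le hc0.le] at ht
    have : min (t * (s / c)) ((1 - t) * (s / (1 - c))) = t * (s / c) := by
      refine min_eq_left ?_
      rw [mul_div_assoc', mul_div_assoc', div_le_div_iff₀ hc0 h1c]
      nlinarith [ht.2]
    simp only [this, mul_pow]
  have e2 : ∫ t in c..1, (min (t * (s / c)) ((1 - t) * (s / (1 - c)))) ^ n =
      ∫ t in c..1, (1 - t) ^ n * (s / (1 - c)) ^ n := by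
    refine intervalIntegral.integral_congr fun t ht => ?_
    rw [Set.uIcc_of_le hc1.le] at ht
    have : min (t * (s / c)) ((1 - t) * (s / (1 - c))) = (1 - t) * (s / (1 - c)) := by
      refine min_eq_right ?_
      rw [mul_div_assoc', mul_div_assoc', div_le_div_iff₀ h1c hc0]
      nlinarith [ht.1]
    simp only [this, mul_pow]
  have e3 : ∫ t in c..1, (1 - t) ^ n = (1 - c) ^ (n + 1) / (n + 1) := by
    rw [intervalIntegral.integral_comp_sub_left (fun t => t ^ n) 1, sub_self, integral_pow]
    simp
  rw [e1, e2, intervalIntegral.integral_mul_const, intervalIntegral.integral_mul_const, e3,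
    integral_pow, div_pow, div_pow]
  field_simp
  ring

/-- The sector contains the double cone with apexes 0 and `u` over the disk of radius sin φ centred
at cos φ on the axis. A reflection moves `u` to the first basis vector, where the volume is computed
by slicing. -/
theorem le_volume_ballSector {n : ℕ} (hn : 0 < n) {u : EuclideanSpace ℝ (Fin (n + 1))}
    (hu : ‖u‖ = 1) {φ : ℝ} (hφ0 : 0 < φ) (hφ : φ < Real.pi / 2) :
    ENNReal.ofReal (Real.sin φ ^ n / (n + 1) * unitBallVolume n) ≤ volume (ballSector u φ) := by
  have hs : 0 < Real.sin φ := Real.sin_pos_of_pos_of_lt_pi hφ0 (by linarith)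
  have hc0 : 0 < Real.cos φ := Real.cos_pos_of_mem_Ioo ⟨by linarith, hφ⟩
  have hsc := Real.sin_sq_add_cos_sq φ
  have hc1 : Real.cos φ < 1 := by nlinarith
  set s := Real.sin φ
  set c := Real.cos φ with hc
  have h1c : 0 < 1 - c := by linarith
  set r : ℝ → ℝ := fun t => min (t * (s / c)) ((1 - t) * (s / (1 - c))) with hr
  have hrc : Continuous r := by fun_prop
  let D : Set (ℝ × EuclideanSpace ℝ (Fin n)) := {p | p.1 ∈ Set.Ioc (0 : ℝ) 1 ∧ ‖p.2‖ < r p.1}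
  have hDm : MeasurableSet D := by
    refine (measurable_fst measurableSet_Ioc).inter ?_
    exact (isOpen_lt (by fun_prop) (by fun_prop : Continuous fun p :
      ℝ × EuclideanSpace ℝ (Fin n) => r p.1)).measurableSet
  set u₀ : EuclideanSpace ℝ (Fin (n + 1)) := EuclideanSpace.single 0 1 with hu₀
  have hu₀n : ‖u₀‖ = 1 := by simp [hu₀]
  have hsub : splitFirst n ⁻¹' D ⊆ ballSector u₀ φ := by
    intro y hy
    obtain ⟨⟨ht0, ht1⟩, hz⟩ := hy
    have hny := norm_sq_splitFirst y
    have hin : ⟪u₀, y⟫ = (splitFirst n y).1 := by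
      rw [splitFirst_fst, hu₀, EuclideanSpace.inner_single_left]
      simp
    set t := (splitFirst n y).1
    set z := ‖(splitFirst n y).2‖ with hzdef
    have hz0 : 0 ≤ z := norm_nonneg _
    have hz1 : z < t * (s / c) := hz.trans_le (min_le_left _ _)
    have hz2 : z < (1 - t) * (s / (1 - c)) := hz.trans_le (min_le_right _ _)
    have hz1' : z * c < t * s := by
      rwa [mul_div_assoc', lt_div_iff₀ hc0] at hz1
    have hz2' : z * (1 - c) < (1 - t) * s := by
      rwa [mul_div_assoc', lt_div_iff₀ h1c] at hz2
    have hz1'' : (z * c) ^ 2 < (t * s) ^ 2 := pow_lt_pow_left₀ hz1' (by positivity) two_ne_zero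
    have hz2'' : (z * (1 - c)) ^ 2 < ((1 - t) * s) ^ 2 :=
      pow_lt_pow_left₀ hz2' (by positivity) two_ne_zero
    have hs2 : s ^ 2 = 1 - c ^ 2 := by linarith
    refine ⟨?_, ?_⟩
    · have : ‖y‖ ^ 2 < 1 := by
        rw [hny]
        rw [mul_pow, mul_pow, hs2] at hz1'' hz2''
        rcases le_total t c with htc | htc
        · have : c ^ 2 * (t ^ 2 + z ^ 2) < c ^ 2 * 1 := by nlinarith
          exact lt_of_mul_lt_mul_left this (sq_nonneg c)
        · have h3 : (1 - t) ^ 2 * (1 - c ^ 2) ≤ (1 - c) ^ 2 * (1 - t ^ 2) := by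
            have e : (1 - c) ^ 2 * (1 - t ^ 2) - (1 - t) ^ 2 * (1 - c ^ 2)
                = 2 * ((1 - t) * (1 - c) * (t - c)) := by ring
            have : 0 ≤ (1 - t) * (1 - c) * (t - c) :=
              mul_nonneg (mul_nonneg (by linarith) h1c.le) (by linarith)
            linarith
          have : (1 - c) ^ 2 * (t ^ 2 + z ^ 2) < (1 - c) ^ 2 * 1 := by nlinarith
          exact lt_of_mul_lt_mul_left this (sq_nonneg _)
      exact (sq_lt_one_iff₀ (norm_nonneg _)).1 this
    · rw [hin]
      refine abs_lt_of_sq_lt_sq' ?_ ht0.le |>.2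
      rw [mul_pow, hny]
      nlinarith
  have hDvol : volume D = ENNReal.ofReal (s ^ n / (n + 1) * unitBallVolume n) := by
    rw [Measure.volume_eq_prod, Measure.prod_apply hDm]
    have hslice : ∀ t : ℝ, volume (Prod.mk t ⁻¹' D) =
        (Set.Ioc (0 : ℝ) 1).indicator (fun t => ENNReal.ofReal (r t ^ n * unitBallVolume n)) t := by
      intro t
      by_cases ht : t ∈ Set.Ioc (0 : ℝ) 1
      · have hset : Prod.mk t ⁻¹' D = Metric.ball 0 (r t) := by
          ext z
          simp only [Set.mem_preimage, Metric.mem_ball, dist_zero_right, D, Set.mem_ofPred_eq]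
          exact ⟨fun h => h.2, fun h => ⟨ht, h⟩⟩
        have hrt : 0 ≤ r t := le_min (by have := ht.1; positivity)
          (mul_nonneg (by linarith [ht.2]) (by positivity))
        rw [Set.indicator_of_mem ht, hset, volume_ball_zero hn, ← ENNReal.ofReal_pow hrt,
          ENNReal.ofReal_mul (by positivity)]
      · rw [Set.indicator_of_notMem ht]
        have hset : Prod.mk t ⁻¹' D = ∅ := by
          ext z
          simp only [Set.mem_preimage, D, Set.mem_ofPred_eq, Set.mem_empty_iff_false, iff_false]
          exact fun h => ht h.1
        rw [hset, measure_empty]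
    simp_rw [hslice]
    rw [lintegral_indicator measurableSet_Ioc, ← ofReal_integral_eq_lintegral_ofReal,
      ← intervalIntegral.integral_of_le zero_le_one, intervalIntegral.integral_mul_const,
      integral_min_pow n hs hc0 hc1]
    · exact ((hrc.pow n).mul continuous_const).integrableOn_Ioc
    · refine (ae_restrict_iff' measurableSet_Ioc).2 (Filter.Eventually.of_forall fun t ht => ?_)
      have hrt : 0 ≤ r t := le_min (by have := ht.1; positivity)
          (mul_nonneg (by linarith [ht.2]) (by positivity))
      exact mul_nonneg (pow_nonneg hrt n) (unitBallVolume_pos n).le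
  rw [volume_ballSector_eq hu hu₀n, ← hDvol,
    ← (measurePreserving_splitFirst n).measure_preimage hDm.nullMeasurableSet]
  exact measure_mono hsub

/-- Log-convexity of Γ: for x = (n + 1) / 2, Γ(x + 1/2)² ≤ Γ(x) Γ(x + 1) = Γ(x + 1)² / x. -/
theorem unitBallVolume_ratio_le {n : ℕ} :
    (n + 1) * unitBallVolume (n + 1) ≤ √(2 * Real.pi * (n + 1 : ℕ)) * unitBallVolume n := by
  set x : ℝ := ((n + 1 : ℕ) : ℝ) / 2 with hx
  have hx0 : 0 < x := by positivity
  have hG0 : 0 < Real.Gamma (x + 1) := Real.Gamma_pos_of_pos (by positivity)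
  have hH0 : 0 < Real.Gamma (x + 1 / 2) := Real.Gamma_pos_of_pos (by positivity)
  have e1 : (n : ℝ) / 2 + 1 = x + 1 / 2 := by rw [hx]; push_cast; ring
  have hconv : Real.Gamma (x + 1 / 2) ^ 2 * x ≤ Real.Gamma (x + 1) ^ 2 := by
    have hG := Real.Gamma_pos_of_pos hx0
    have h := Real.Gamma_mul_add_mul_le_rpow_Gamma_mul_rpow_Gamma hx0 (by positivity : 0 < x + 1)
      (by norm_num : (0 : ℝ) < 1 / 2) (by norm_num : (0 : ℝ) < 1 / 2) (by norm_num)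
    rw [show 1 / 2 * x + 1 / 2 * (x + 1) = x + 1 / 2 by ring, ← Real.sqrt_eq_rpow,
      ← Real.sqrt_eq_rpow] at h
    have h2 := pow_le_pow_left₀ hH0.le h 2
    rw [mul_pow, Real.sq_sqrt hG.le, Real.sq_sqrt hG0.le] at h2
    calc Real.Gamma (x + 1 / 2) ^ 2 * x ≤ Real.Gamma x * Real.Gamma (x + 1) * x :=
          mul_le_mul_of_nonneg_right h2 hx0.le
      _ = Real.Gamma (x + 1) ^ 2 := by rw [Real.Gamma_add_one hx0.ne']; ring
  have e2 : √(2 * Real.pi * (n + 1 : ℕ)) = 2 * √Real.pi * √x := by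
    rw [hx, show 2 * Real.pi * ((n + 1 : ℕ) : ℝ) = 2 ^ 2 * (Real.pi * (((n + 1 : ℕ) : ℝ) / 2)) by ring,
      Real.sqrt_mul (by positivity), Real.sqrt_sq (by norm_num), Real.sqrt_mul Real.pi_pos.le]
    ring
  have e3 : (n : ℝ) + 1 = 2 * (√x * √x) := by
    rw [Real.mul_self_sqrt hx0.le, hx]; push_cast; ring
  have hroot : Real.Gamma (x + 1 / 2) * √x ≤ Real.Gamma (x + 1) := by
    refine abs_le_of_sq_le_sq' ?_ hG0.le |>.2
    rw [mul_pow, Real.sq_sqrt hx0.le]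
    exact hconv
  rw [unitBallVolume, unitBallVolume, e1, e2, e3, ← hx, pow_succ, mul_div_assoc', mul_div_assoc',
    div_le_div_iff₀ hG0 hH0]
  have : 0 ≤ 2 * √x * √Real.pi ^ n * √Real.pi := by positivity
  nlinarith [mul_le_mul_of_nonneg_left hroot this]

/-- The volume bound for packings of spherical caps of radius `φ`. -/
theorem card_le_of_pairwise_angle {n : ℕ} (hn : 0 < n) {φ : ℝ} (hφ0 : 0 < φ)
    (hφ : φ < Real.pi / 2) {V : Finset (EuclideanSpace ℝ (Fin (n + 1)))}
    (hV : ∀ v ∈ V, ‖v‖ = 1) (hsep : ∀ u ∈ V, ∀ v ∈ V, u ≠ v → 2 * φ ≤ angle u v) :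
    (V.card : ℝ) ≤ √(2 * Real.pi * (n + 1 : ℕ)) * (1 / Real.sin φ) ^ n := by
  have hs : 0 < Real.sin φ := Real.sin_pos_of_pos_of_lt_pi hφ0 (by linarith [Real.pi_pos])
  have hκ := unitBallVolume_pos n
  set a := Real.sin φ ^ n / (n + 1) * unitBallVolume n with ha
  have ha0 : 0 < a := by positivity
  have h1 : ENNReal.ofReal (V.card * a) ≤ ENNReal.ofReal (unitBallVolume (n + 1)) := by
    calc ENNReal.ofReal (V.card * a) = ∑ v ∈ V, ENNReal.ofReal a := by
          rw [Finset.sum_const, nsmul_eq_mul, ENNReal.ofReal_mul (by positivity),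
            ENNReal.ofReal_natCast]
      _ ≤ ∑ v ∈ V, volume (ballSector v φ) :=
          Finset.sum_le_sum fun v hv => le_volume_ballSector hn (hV v hv) hφ0 hφ
      _ = volume (⋃ v ∈ V, ballSector v φ) := by
          rw [measure_biUnion_finset (fun u hu v hv huv => ?_)
            fun v _ => (isOpen_ballSector v φ).measurableSet]
          exact disjoint_ballSector hφ0.le (by linarith [Real.pi_pos]) (hV u hu) (hV v hv)
            (hsep u hu v hv huv)
      _ ≤ volume (Metric.ball (0 : EuclideanSpace ℝ (Fin (n + 1))) 1) := by
          refine measure_mono (Set.iUnion₂_subset fun v _ y hy => ?_)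
          simpa using hy.1
      _ = ENNReal.ofReal (unitBallVolume (n + 1)) := by
          rw [volume_ball_zero n.succ_pos, ENNReal.ofReal_one, one_pow, one_mul]
  have h2 : V.card * a ≤ unitBallVolume (n + 1) :=
    (ENNReal.ofReal_le_ofReal_iff (unitBallVolume_pos _).le).1 h1
  have h3 : (V.card * Real.sin φ ^ n) * unitBallVolume n ≤
      √(2 * Real.pi * (n + 1 : ℕ)) * unitBallVolume n := by
    refine le_trans (le_of_eq ?_) ((mul_le_mul_of_nonneg_left h2
      (by positivity : (0 : ℝ) ≤ n + 1)).trans unitBallVolume_ratio_le)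
    rw [ha]
    field_simp
  rw [div_pow, one_pow, mul_one_div, le_div_iff₀ (by positivity)]
  exact le_of_mul_le_mul_right h3 hκ

/-- A maximal separated set of directions. -/
theorem exists_dense_directions {n : ℕ} (hn : 0 < n) {δ : ℝ} (hδ0 : 0 < δ) (hδ : δ < Real.pi) :
    ∃ V : Finset (EuclideanSpace ℝ (Fin (n + 1))), (∀ v ∈ V, ‖v‖ = 1) ∧
      (∀ u : EuclideanSpace ℝ (Fin (n + 1)), ‖u‖ = 1 → ∃ v ∈ V, angle u v < δ) ∧
      (V.card : ℝ) ≤ √(2 * Real.pi * (n + 1 : ℕ)) * (1 / Real.sin (δ / 2)) ^ n := by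
  classical
  set P : Finset (EuclideanSpace ℝ (Fin (n + 1))) → Prop := fun V =>
    (∀ v ∈ V, ‖v‖ = 1) ∧ ∀ u ∈ V, ∀ v ∈ V, u ≠ v → δ ≤ angle u v with hP
  have hbound : ∀ V, P V →
      (V.card : ℝ) ≤ √(2 * Real.pi * (n + 1 : ℕ)) * (1 / Real.sin (δ / 2)) ^ n := fun V hV =>
    card_le_of_pairwise_angle hn (by linarith) (by linarith) hV.1 fun u hu v hv huv => by
      rw [mul_div_cancel₀ _ two_ne_zero]
      exact hV.2 u hu v hv huv
  -- The packing bound limits the size of separated sets, so a largest one exists. A direction at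
  -- angle at least δ from all its points could be added to it.
  set A : Set ℕ := {k | ∃ V, P V ∧ V.card = k} with hA
  have hne : A.Nonempty := ⟨0, ∅, ⟨by simp, by simp⟩, rfl⟩
  have hbdd : BddAbove A := by
    refine ⟨⌊√(2 * Real.pi * (n + 1 : ℕ)) * (1 / Real.sin (δ / 2)) ^ n⌋₊, ?_⟩
    rintro k ⟨V, hV, rfl⟩
    exact Nat.le_floor (hbound V hV)
  obtain ⟨V, hV, hcard⟩ := Nat.sSup_mem hne hbdd
  refine ⟨V, hV.1, fun u hu => ?_, hbound V hV⟩
  by_contra! hfar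
  have huV : u ∉ V := fun h => by
    have := hfar u h
    rw [angle_self (norm_ne_zero_iff.1 (by rw [hu]; exact one_ne_zero))] at this
    linarith
  have hins : P (insert u V) := by
    refine ⟨fun v hv => ?_, fun x hx y hy hxy => ?_⟩
    · rcases Finset.mem_insert.1 hv with rfl | hv
      exacts [hu, hV.1 v hv]
    · rcases Finset.mem_insert.1 hx with hxu | hxV <;> rcases Finset.mem_insert.1 hy with hyu | hyV
      · exact absurd (hxu.trans hyu.symm) hxy
      · exact hxu ▸ hfar y hyV
      · rw [angle_comm]
        exact hyu ▸ hfar x hxV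
      · exact hV.2 x hxV y hyV hxy
  have := le_csSup hbdd ⟨insert u V, hins, rfl⟩
  rw [Finset.card_insert_of_notMem huV, hcard] at this
  omega

end SphericalPacking

/-! ### Facets of polytopes by polarity. -/

section PolytopeFacets

variable {E : Type*} [NormedAddCommGroup E] [InnerProductSpace ℝ E]

theorem real_inner_le_of_mem_convexHull {s : Set E} {n c : E} {b : ℝ}
    (h : ∀ v ∈ s, ⟪n, v - c⟫ ≤ b) : ∀ x ∈ convexHull ℝ s, ⟪n, x - c⟫ ≤ b := by
  intro x hx
  have hconv : Convex ℝ {x : E | ⟪n, x⟫ ≤ b + ⟪n, c⟫} :=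
    convex_halfSpace_le (innerₛₗ ℝ n).isLinear _
  have hs : s ⊆ {x : E | ⟪n, x⟫ ≤ b + ⟪n, c⟫} := fun v hv => by
    have := h v hv
    rw [inner_sub_right] at this
    show ⟪n, v⟫ ≤ _
    linarith
  have : ⟪n, x⟫ ≤ b + ⟪n, c⟫ := convexHull_min hs hconv hx
  rw [inner_sub_right]
  linarith

/-- A point outside of a polytope around the origin is separated from the polytope by the
hyperplane of a facet. -/
theorem exists_facet_normal_of_notMem [FiniteDimensional ℝ E] {s : Set E} (hs : s.Finite) {ε : ℝ} (hε : 0 < ε)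
    (hball : Metric.ball 0 ε ⊆ convexHull ℝ s) {y : E} (hy : y ∉ convexHull ℝ s) :
    ∃ ν : E, (∀ v ∈ s, ⟪ν, v⟫ ≤ 1) ∧ 1 < ⟪ν, y⟫ ∧
      Submodule.span ℝ {v ∈ s | ⟪ν, v⟫ = 1} = ⊤ := by
  -- The polar body, compact because the hull contains a ball. Its vertices correspond to facets,
  -- and one that maximises ⟪y, ·⟫ gives a facet separating `y`.
  set P : Set E := {ν | ∀ v ∈ s, ⟪ν, v⟫ ≤ 1} with hP
  have hPc : IsCompact P := by
    refine Metric.isCompact_of_isClosed_isBounded ?_ ?_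
    · have : P = ⋂ v ∈ s, {ν : E | ⟪ν, v⟫ ≤ 1} := by
        ext ν
        simp [hP]
      rw [this]
      exact isClosed_biInter fun v _ =>
        isClosed_le (continuous_id.inner continuous_const) continuous_const
    · refine (Metric.isBounded_iff_subset_closedBall 0).2 ⟨2 / ε, fun ν hν => ?_⟩
      rw [mem_closedBall_zero_iff]
      rcases eq_or_ne ν 0 with rfl | hν0
      · rw [norm_zero]
        positivity
      have hνn : 0 < ‖ν‖ := norm_pos_iff.2 hν0
      have hmem : (ε / 2 * ‖ν‖⁻¹) • ν ∈ convexHull ℝ s := by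
        refine hball ?_
        rw [mem_ball_zero_iff, norm_smul, Real.norm_of_nonneg (by positivity),
          inv_mul_cancel_right₀ hνn.ne']
        linarith
      have h1 := real_inner_le_of_mem_convexHull (n := ν) (c := 0) (b := 1)
        (fun v hv => by simpa using hν v hv) _ hmem
      rw [sub_zero, real_inner_smul_right, real_inner_self_eq_norm_sq] at h1
      rw [le_div_iff₀ hε]
      have : ε / 2 * ‖ν‖⁻¹ * ‖ν‖ ^ 2 = ε / 2 * ‖ν‖ := by field_simp
      linarith
  have hcl : IsClosed (convexHull ℝ s) := (hs.isCompact_convexHull ℝ).isClosed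
  obtain ⟨f, u, hfu, huy⟩ := geometric_hahn_banach_closed_point (convex_convexHull ℝ s) hcl hy
  set ν₀ : E := (InnerProductSpace.toDual ℝ E).symm f with hν₀
  have hf : ∀ x, ⟪ν₀, x⟫ = f x := fun x => InnerProductSpace.toDual_symm_apply
  have hu0 : 0 < u := by simpa using hfu 0 (hball (Metric.mem_ball_self hε))
  have hν₀P : u⁻¹ • ν₀ ∈ P := fun v hv => by
    rw [real_inner_smul_left, hf, inv_mul_le_iff₀ hu0, mul_one]
    exact (hfu v (subset_convexHull ℝ s hv)).le
  have hν₀y : 1 < ⟪u⁻¹ • ν₀, y⟫ := by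
    rw [real_inner_smul_left, hf, lt_inv_mul_iff₀ hu0, mul_one]
    exact huy
  set l : StrongDual ℝ E := innerSL ℝ y with hl
  have hexp : IsExposed ℝ P (l.toExposed P) := ContinuousLinearMap.toExposed.isExposed
  obtain ⟨ν₁, hν₁P, hν₁⟩ := hPc.exists_isMaxOn ⟨_, hν₀P⟩ l.continuous.continuousOn
  obtain ⟨ν, hν⟩ := (hexp.isCompact hPc).extremePoints_nonempty ⟨ν₁, hν₁P, hν₁⟩
  have hνexp := hν.1
  have hνext := hexp.isExtreme.extremePoints_subset_extremePoints hν
  refine ⟨ν, hνexp.1, ?_, ?_⟩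
  · have : ⟪y, u⁻¹ • ν₀⟫ ≤ ⟪y, ν⟫ := hνexp.2 _ hν₀P
    rw [real_inner_comm ν y, real_inner_comm (u⁻¹ • ν₀) y] at this
    exact hν₀y.trans_le this
  -- If the tight constraints did not span, `ν` could be moved both ways along a `w` orthogonal to
  -- them without leaving `P`, against extremality.
  · by_contra hspan
    obtain ⟨w, hw, hw0⟩ : ∃ w ∈ (Submodule.span ℝ {v ∈ s | ⟪ν, v⟫ = 1})ᗮ, w ≠ 0 := by
      have : (Submodule.span ℝ {v ∈ s | ⟪ν, v⟫ = 1})ᗮ ≠ ⊥ :=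
        fun h => hspan (Submodule.orthogonal_eq_bot_iff.1 h)
      exact Submodule.exists_mem_ne_zero_of_ne_bot this
    have hsmall : ∃ η : ℝ, 0 < η ∧ ∀ v ∈ s, η * |⟪w, v⟫| + ⟪ν, v⟫ ≤ 1 := by
      have hev : ∀ v ∈ s, ∀ᶠ η : ℝ in nhdsWithin 0 (Set.Ioi 0), η * |⟪w, v⟫| + ⟪ν, v⟫ ≤ 1 := by
        intro v hv
        rcases (hνexp.1 v hv).eq_or_lt with h1 | h1
        · have : ⟪w, v⟫ = 0 := by
            rw [real_inner_comm]
            exact (Submodule.mem_orthogonal _ _).1 hw v (Submodule.subset_span ⟨hv, h1⟩)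
          exact Filter.Eventually.of_forall fun η => by rw [this, abs_zero, mul_zero, zero_add, h1]
        · have hcont : Filter.Tendsto (fun η : ℝ => η * |⟪w, v⟫| + ⟪ν, v⟫) (nhds 0)
              (nhds (0 * |⟪w, v⟫| + ⟪ν, v⟫)) :=
            Continuous.tendsto (by fun_prop) 0
          rw [zero_mul, zero_add] at hcont
          exact ((hcont.eventually_lt_const h1).mono fun _ h => h.le).filter_mono nhdsWithin_le_nhds
      have hall := (Filter.eventually_all_finite hs).2 hev
      obtain ⟨η, hη, hη0⟩ := (hall.and self_mem_nhdsWithin).exists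
      exact ⟨η, hη0, hη⟩
    obtain ⟨η, hη0, hη⟩ := hsmall
    have hadd : ν + η • w ∈ P := fun v hv => by
      rw [inner_add_left, real_inner_smul_left]
      nlinarith [hη v hv, le_abs_self ⟪w, v⟫]
    have hsub : ν - η • w ∈ P := fun v hv => by
      rw [inner_sub_left, real_inner_smul_left]
      nlinarith [hη v hv, neg_abs_le ⟪w, v⟫]
    have := (mem_extremePoints.1 hνext).2 _ hadd _ hsub
      ⟨1 / 2, 1 / 2, by norm_num, by norm_num, by norm_num, by module⟩
    have h0 : η • w = 0 := by simpa using this.1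
    rcases smul_eq_zero.1 h0 with h0 | h0
    exacts [hη0.ne' h0, hw0 h0]

/-- An exposed face of a polytope is spanned by its vertices. -/
theorem IsExposed.subset_convexHull_inter {s F : Set E} (hs : s.Finite)
    (hF : IsExposed ℝ (convexHull ℝ s) F) : F ⊆ convexHull ℝ (s ∩ F) := by
  have hQ := hs.isCompact_convexHull ℝ
  have hFc := hF.isCompact hQ
  have hFconv := hF.convex (convex_convexHull ℝ s)
  have hext : F.extremePoints ℝ ⊆ s ∩ F := fun x hx =>
    ⟨extremePoints_convexHull_subset (hF.isExtreme.extremePoints_subset_extremePoints hx), hx.1⟩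
  rw [← closure_convexHull_extremePoints hFc hFconv]
  refine closure_minimal ((convexHull_mono hext).trans ?_) ?_
  · rw [closure_convexHull_extremePoints hFc hFconv]
  · exact ((hs.subset Set.inter_subset_left).isCompact_convexHull ℝ).isClosed

theorem isExposed_setOf_inner_le (Q : Set E) (n : E) :
    IsExposed ℝ Q {x ∈ Q | ∀ y ∈ Q, ⟪n, y⟫ ≤ ⟪n, x⟫} :=
  fun _ => ⟨innerSL ℝ n, rfl⟩

theorem vectorSpan_le_orthogonal {G : Set E} {n : E} (h : ∀ x ∈ G, ∀ y ∈ G, ⟪n, x⟫ = ⟪n, y⟫) :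
    vectorSpan ℝ G ≤ (ℝ ∙ n)ᗮ := by
  rw [vectorSpan, Submodule.span_le]
  rintro _ ⟨x, hx, y, hy, rfl⟩
  rw [SetLike.mem_coe, Submodule.mem_orthogonal_singleton_iff_inner_right]
  simp only [vsub_eq_sub, inner_sub_right]
  rw [h x hx y hy, sub_self]

/-- Moving the base point from `c` to a point `p` of `G` costs only the direction `p - c`. -/
theorem finrank_le_finrank_vectorSpan_add_one [FiniteDimensional ℝ E] {G : Set E} {p c : E} (hp : p ∈ G)
    {W : Submodule ℝ E} (hW : W ≤ Submodule.span ℝ ((fun x => x - c) '' G)) :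
    Module.finrank ℝ W ≤ Module.finrank ℝ (vectorSpan ℝ G) + 1 := by
  have h1 : W ≤ vectorSpan ℝ G ⊔ (ℝ ∙ (p - c)) := by
    refine hW.trans (Submodule.span_le.2 ?_)
    rintro _ ⟨x, hx, rfl⟩
    have e : x - c = (x - p) + (p - c) := by abel
    simp only [SetLike.mem_coe]
    rw [e]
    exact Submodule.add_mem_sup (vsub_mem_vectorSpan ℝ hx hp) (Submodule.mem_span_singleton_self _)
  calc Module.finrank ℝ W ≤ _ := Submodule.finrank_mono h1
    _ ≤ _ := Submodule.finrank_add_le_finrank_add_finrank _ _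
    _ ≤ _ := by
      have := finrank_span_le_card (R := ℝ) ({p - c} : Set E)
      simp only [Set.toFinset_singleton, Finset.card_singleton] at this
      omega

end PolytopeFacets

/-! ### Existence of facets and of adjacent facets. -/

section AdjacentFacets

variable {N : ℕ} {s : Set (EuclideanSpace ℝ (Fin N))}

/-- A point of the hyperplane of a facet `F` that does not belong to `F` is cut off by a facet
adjacent to `F`. -/
theorem exists_adjacent_facet_of_notMem (hs : s.Finite)
    (hint : (interior (convexHull ℝ s)).Nonempty) {F : Set (EuclideanSpace ℝ (Fin N))}
    {e : EuclideanSpace ℝ (Fin N)} (he : ‖e‖ = 1)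
    (hF : F = {x ∈ convexHull ℝ s | ∀ y ∈ convexHull ℝ s, ⟪e, y⟫ ≤ ⟪e, x⟫})
    {c : EuclideanSpace ℝ (Fin N)} (hcF : c ∈ F) {r : ℝ} (hr : 0 < r)
    (hdisk : ∀ z, ⟪e, z⟫ = 0 → ‖z‖ < r → c + z ∈ F) {y : EuclideanSpace ℝ (Fin N)} (hyF : y ∉ F)
    (hye : ⟪e, y⟫ = ⟪e, c⟫) :
    ∃ (ν : EuclideanSpace ℝ (Fin N)) (C D : ℝ) (G : Set (EuclideanSpace ℝ (Fin N))) (b : ℝ),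
      ‖ν‖ = 1 ∧ ⟪ν, e⟫ = 0 ∧ 0 < D ∧ C ^ 2 + D ^ 2 = 1 ∧ IsPolytopeFace (convexHull ℝ s) G ∧
      AreAdjacentFaces F G ∧ IsOutwardUnitNormal (convexHull ℝ s) G (C • e + D • ν) ∧
      (∀ x ∈ convexHull ℝ s, ⟪C • e + D • ν, x⟫ ≤ b) ∧ b < ⟪C • e + D • ν, y⟫ := by
  classical
  set Q := convexHull ℝ s with hQ
  have hsQ : s ⊆ Q := subset_convexHull ℝ s
  have he0 : e ≠ 0 := norm_ne_zero_iff.1 (by rw [he]; exact one_ne_zero)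
  have hcQ : c ∈ Q := (hF ▸ hcF).1
  have hQe : ∀ x ∈ Q, ⟪e, x⟫ ≤ ⟪e, c⟫ := (hF ▸ hcF).2
  have hFmem : ∀ x, x ∈ F ↔ x ∈ Q ∧ ⟪e, x⟫ = ⟪e, c⟫ := by
    intro x
    rw [hF]
    exact ⟨fun h => ⟨h.1, le_antisymm (hQe x h.1) (h.2 c hcQ)⟩,
      fun h => ⟨h.1, fun y hy => (hQe y hy).trans h.2.ge⟩⟩
  have hFQ : F ⊆ Q := fun x hx => ((hFmem x).1 hx).1
  have hFexp : IsExposed ℝ Q F := hF ▸ isExposed_setOf_inner_le Q e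
  have hFhull : F ⊆ convexHull ℝ (s ∩ F) := hFexp.subset_convexHull_inter hs
  have hFconv : Convex ℝ F := hFexp.convex (convex_convexHull ℝ s)
  -- In the hyperplane of `F` with origin `c`, the vertices of `F` span a polytope around 0, so
  -- polarity gives a normal `ν'` whose ridge cuts `y` off.
  set W := (ℝ ∙ e)ᗮ with hW
  have hWmem : ∀ x, x ∈ W ↔ ⟪e, x⟫ = 0 := fun x =>
    Submodule.mem_orthogonal_singleton_iff_inner_right
  have hWfr : Module.finrank ℝ W + 1 = N := by
    rw [finrank_orthogonal_span_singleton_add_one he0, finrank_euclideanSpace_fin]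
  set f : W → EuclideanSpace ℝ (Fin N) := fun z => c + z with hf
  have hfinj : Function.Injective f := fun a b h => Subtype.ext (add_left_cancel h)
  set T' : Set W := f ⁻¹' (s ∩ F) with hT'
  have hT'fin : T'.Finite := (hs.subset Set.inter_subset_left).preimage hfinj.injOn
  have hfT' : f '' T' = s ∩ F := by
    refine Set.image_preimage_eq_of_subset fun v hv => ?_
    refine ⟨⟨v - c, (hWmem _).2 ?_⟩, add_sub_cancel c v⟩
    rw [inner_sub_right, ((hFmem v).1 hv.2).2, sub_self]
  have hfconv : f '' convexHull ℝ T' = convexHull ℝ (s ∩ F) := by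
    have := (W.subtype.toAffineMap + AffineMap.const ℝ W c).image_convexHull T'
    have e1 : ⇑(W.subtype.toAffineMap + AffineMap.const ℝ W c) = f := by
      funext z
      simp [hf, add_comm]
    rw [e1, hfT'] at this
    exact this
  have hconvT' : ∀ z : W, f z ∈ F ↔ z ∈ convexHull ℝ T' := by
    intro z
    constructor
    · intro hz
      obtain ⟨z', hz', heq⟩ := hfconv.symm ▸ hFhull hz
      exact hfinj heq ▸ hz'
    · intro hz
      exact convexHull_min Set.inter_subset_right hFconv (hfconv ▸ Set.mem_image_of_mem f hz)
  have hball : Metric.ball 0 r ⊆ convexHull ℝ T' := by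
    intro z hz
    rw [mem_ball_zero_iff] at hz
    exact (hconvT' z).1 (hdisk z ((hWmem _).1 z.2) hz)
  have hyW : y - c ∈ W := (hWmem _).2 (by rw [inner_sub_right, hye, sub_self])
  have hfy : f ⟨y - c, hyW⟩ = y := add_sub_cancel c y
  obtain ⟨ν', hν's, hν'y, hν'span⟩ := exists_facet_normal_of_notMem hT'fin hr hball
    (y := ⟨y - c, hyW⟩) (fun h => hyF (hfy ▸ (hconvT' _).2 h))
  have hν'e : ⟪e, (ν' : EuclideanSpace ℝ (Fin N))⟫ = 0 := (hWmem _).1 ν'.2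
  have hν'y' : 1 < ⟪(ν' : EuclideanSpace ℝ (Fin N)), y - c⟫ := hν'y
  have hν'0 : (ν' : EuclideanSpace ℝ (Fin N)) ≠ 0 := fun h0 => by
    rw [h0, inner_zero_left] at hν'y'
    linarith
  have hν'n : 0 < ‖(ν' : EuclideanSpace ℝ (Fin N))‖ := norm_pos_iff.2 hν'0
  -- vertices off the facet
  have hoff : ∃ v ∈ s, v ∉ F := by
    by_contra! hall
    have hQF : Q ⊆ F := convexHull_min hall hFconv
    obtain ⟨p, hp⟩ := hint
    obtain ⟨ε, hε, hpε⟩ := Metric.isOpen_iff.1 isOpen_interior p hp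
    have hmem : p + (ε / 2) • e ∈ Q := interior_subset (hpε (by
      rw [Metric.mem_ball, dist_eq_norm, add_sub_cancel_left, norm_smul, he,
        Real.norm_of_nonneg (by positivity)]
      linarith))
    have h1 := ((hFmem _).1 (hQF (interior_subset hp))).2
    have h2 := ((hFmem _).1 (hQF hmem)).2
    rw [inner_add_right, real_inner_smul_right, real_inner_self_eq_norm_sq, he] at h2
    linarith
  have hneg : ∀ v ∈ s, v ∉ F → ⟪e, v - c⟫ < 0 := by
    intro v hv hvF
    have h1 : ⟪e, v⟫ ≠ ⟪e, c⟫ := fun h => hvF ((hFmem v).2 ⟨hsQ hv, h⟩)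
    have h2 := lt_of_le_of_ne (hQe v (hsQ hv)) h1
    rw [inner_sub_right]
    linarith
  -- Rotation about the ridge: a vertex `v` off `F` satisfies ⟪κ e + ν', v - c⟫ ≤ 1 exactly when κ ≥
  -- slope v. The maximal slope gives a supporting hyperplane that also touches some `v₁` off `F`.
  set slope : EuclideanSpace ℝ (Fin N) → ℝ := fun v =>
    (⟪(ν' : EuclideanSpace ℝ (Fin N)), v - c⟫ - 1) / -⟪e, v - c⟫ with hslope
  obtain ⟨v₁, ⟨hv₁s, hv₁F⟩, hv₁⟩ : ∃ v ∈ s \ F, ∀ w ∈ s \ F, slope w ≤ slope v :=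
    Set.exists_max_image (s \ F) slope (hs.subset Set.sdiff_subset) hoff
  set κ := slope v₁ with hκ
  set n₁ : EuclideanSpace ℝ (Fin N) := κ • e + ν' with hn₁
  have hn₁e : ∀ x, ⟪n₁, x⟫ = κ * ⟪e, x⟫ + ⟪(ν' : EuclideanSpace ℝ (Fin N)), x⟫ := fun x => by
    rw [hn₁, inner_add_left, real_inner_smul_left]
  have hv₁eq : ⟪n₁, v₁ - c⟫ = 1 := by
    have h1 := hneg v₁ hv₁s hv₁F
    have h2 : κ * -⟪e, v₁ - c⟫ = ⟪(ν' : EuclideanSpace ℝ (Fin N)), v₁ - c⟫ - 1 := by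
      rw [hκ, hslope]
      exact div_mul_cancel₀ _ (by linarith)
    rw [hn₁e]
    linarith
  have hQn₁ : ∀ x ∈ Q, ⟪n₁, x - c⟫ ≤ 1 := by
    refine real_inner_le_of_mem_convexHull fun v hv => ?_
    rw [hn₁e]
    by_cases hvF : v ∈ F
    · have h1 := ((hFmem v).1 hvF).2
      obtain ⟨z, hz, hzv⟩ : v ∈ f '' T' := by
        rw [hfT']
        exact ⟨hv, hvF⟩
      have h2 : ⟪(ν' : EuclideanSpace ℝ (Fin N)), v - c⟫ ≤ 1 := by
        rw [← hzv, hf]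
        simp only [add_sub_cancel_left]
        exact hν's z hz
      rw [inner_sub_right, h1, sub_self, mul_zero, zero_add]
      exact h2
    · have h1 := hneg v hv hvF
      have h2 := (div_le_iff₀ (by linarith)).1 (hv₁ v ⟨hv, hvF⟩)
      linarith
  clear_value κ
  set q := ‖n₁‖ with hq
  have hn₁sq : q ^ 2 = κ ^ 2 + ‖(ν' : EuclideanSpace ℝ (Fin N))‖ ^ 2 := by
    rw [hq, hn₁, norm_add_sq_real, real_inner_smul_left, hν'e, norm_smul, he, Real.norm_eq_abs,
      mul_one, sq_abs]
    ring
  have hq0 : 0 < q := by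
    have : 0 < q ^ 2 := by rw [hn₁sq]; positivity
    exact lt_of_le_of_ne (norm_nonneg _) fun h => by simp [← h] at this
  set G : Set (EuclideanSpace ℝ (Fin N)) := {x ∈ Q | ∀ y ∈ Q, ⟪q⁻¹ • n₁, y⟫ ≤ ⟪q⁻¹ • n₁, x⟫} with hG
  have hGmem : ∀ x, x ∈ G ↔ x ∈ Q ∧ ⟪n₁, x - c⟫ = 1 := by
    intro x
    have hle : ∀ a b : EuclideanSpace ℝ (Fin N),
        ⟪q⁻¹ • n₁, a⟫ ≤ ⟪q⁻¹ • n₁, b⟫ ↔ ⟪n₁, a - c⟫ ≤ ⟪n₁, b - c⟫ := fun a b => by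
      rw [real_inner_smul_left, real_inner_smul_left, mul_le_mul_iff_right₀ (inv_pos.2 hq0),
        inner_sub_right, inner_sub_right, sub_le_sub_iff_right]
    constructor
    · rintro ⟨hx, h⟩
      have := (hle _ _).1 (h v₁ (hsQ hv₁s))
      exact ⟨hx, le_antisymm (hQn₁ x hx) (hv₁eq ▸ this)⟩
    · rintro ⟨hx, h⟩
      exact ⟨hx, fun y hy => (hle _ _).2 ((hQn₁ y hy).trans h.ge)⟩
  have hv₁G : v₁ ∈ G := (hGmem _).2 ⟨hsQ hv₁s, hv₁eq⟩
  have hcomb : (κ / q) • e + (‖(ν' : EuclideanSpace ℝ (Fin N))‖ / q) •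
      (‖(ν' : EuclideanSpace ℝ (Fin N))‖⁻¹ • (ν' : EuclideanSpace ℝ (Fin N))) = q⁻¹ • n₁ := by
    rw [hn₁, smul_add, smul_smul, smul_smul, div_mul_eq_mul_div, mul_inv_cancel₀ hν'n.ne', one_div,
      inv_mul_eq_div]
  -- the ridge
  set R := F ∩ G with hR
  have hRn : ∀ x ∈ R, ⟪(ν' : EuclideanSpace ℝ (Fin N)), x - c⟫ = 1 := by
    intro x hx
    have h1 := ((hGmem x).1 hx.2).2
    have h2 := ((hFmem x).1 hx.1).2
    rw [hn₁e, inner_sub_right e, h2, sub_self, mul_zero, zero_add] at h1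
    exact h1
  have htight : ∀ z ∈ T', ⟪ν', z⟫ = 1 → f z ∈ R := by
    intro z hz hz1
    have hfzF : f z ∈ F := hz.2
    refine ⟨hfzF, (hGmem _).2 ⟨hFQ hfzF, ?_⟩⟩
    rw [hn₁e, inner_sub_right e, ((hFmem _).1 hfzF).2, sub_self, mul_zero, zero_add, hf]
    simp only [add_sub_cancel_left]
    exact hz1
  have hRspan : W ≤ Submodule.span ℝ ((fun x => x - c) '' R) := by
    have h1 : W = Submodule.map W.subtype ⊤ := by simp
    rw [h1, ← hν'span, Submodule.map_span]
    refine Submodule.span_mono ?_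
    rintro _ ⟨z, ⟨hz, hz1⟩, rfl⟩
    exact ⟨f z, htight z hz hz1, by simp [hf]⟩
  have hRne : R.Nonempty := by
    by_contra hne
    rw [Set.not_nonempty_iff_eq_empty] at hne
    rw [hne, Set.image_empty, Submodule.span_empty] at hRspan
    exact hν'0 ((Submodule.mem_bot ℝ).1 (hRspan ν'.2))
  obtain ⟨p, hp⟩ := hRne
  -- Seen from `c` the ridge spans `W`, so its dimension is at least N - 2; it is below N - 1
  -- because `ν'` is constant on it. Adding `v₁` raises the dimension of `G` to N - 1.
  have hR1 := finrank_le_finrank_vectorSpan_add_one hp hRspan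
  have hRW : vectorSpan ℝ R ≤ W := vectorSpan_le_orthogonal fun a ha b hb => by
    rw [((hFmem a).1 ha.1).2, ((hFmem b).1 hb.1).2]
  have hRν : vectorSpan ℝ R ≤ (ℝ ∙ (ν' : EuclideanSpace ℝ (Fin N)))ᗮ :=
    vectorSpan_le_orthogonal fun a ha b hb => by
      have h1 := hRn a ha
      have h2 := hRn b hb
      rw [inner_sub_right] at h1 h2
      linarith
  have hR2 : Module.finrank ℝ (vectorSpan ℝ R) < Module.finrank ℝ W := by
    refine Submodule.finrank_lt_finrank_of_lt (lt_of_le_of_ne hRW fun h => ?_)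
    have h1 := hRν (h.ge ν'.2)
    rw [Submodule.mem_orthogonal_singleton_iff_inner_right, real_inner_self_eq_norm_sq] at h1
    exact hν'n.ne' (pow_eq_zero_iff two_ne_zero |>.1 h1)
  have hG1 : Module.finrank ℝ (vectorSpan ℝ R) < Module.finrank ℝ (vectorSpan ℝ G) := by
    refine Submodule.finrank_lt_finrank_of_lt
      (lt_of_le_of_ne (vectorSpan_mono ℝ Set.inter_subset_right) fun h => ?_)
    have h1 : v₁ - p ∈ W := hRW (h.ge <| vsub_mem_vectorSpan ℝ hv₁G hp.2)
    rw [hWmem, inner_sub_right, ((hFmem p).1 hp.1).2, ← inner_sub_right] at h1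
    exact (hneg v₁ hv₁s hv₁F).ne h1
  have hG2 : Module.finrank ℝ (vectorSpan ℝ G) + 1 ≤ N := by
    have h0 : n₁ ≠ 0 := norm_pos_iff.1 hq0
    have h1 : vectorSpan ℝ G ≤ (ℝ ∙ n₁)ᗮ := vectorSpan_le_orthogonal fun a ha b hb => by
      have h1 := ((hGmem a).1 ha).2
      have h2 := ((hGmem b).1 hb).2
      rw [inner_sub_right] at h1 h2
      linarith
    have h2 := Submodule.finrank_mono h1
    have h3 := finrank_orthogonal_span_singleton_add_one h0
    rw [finrank_euclideanSpace_fin] at h3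
    omega
  refine ⟨‖(ν' : EuclideanSpace ℝ (Fin N))‖⁻¹ • ν', κ / q, ‖(ν' : EuclideanSpace ℝ (Fin N))‖ / q, G,
    q⁻¹ * (⟪n₁, c⟫ + 1), ?_, ?_, by positivity, ?_, ?_, ?_, ?_, ?_, ?_⟩
  · rw [norm_smul, norm_inv, norm_norm, inv_mul_cancel₀ hν'n.ne']
  · rw [real_inner_smul_left, real_inner_comm, hν'e, mul_zero]
  · rw [div_pow, div_pow, ← add_div, ← hn₁sq, div_self (by positivity)]
  · exact ⟨⟨v₁, hv₁G⟩, isExposed_setOf_inner_le Q _, by omega⟩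
  · exact ⟨fun h => hv₁F (h ▸ hv₁G), ⟨p, hp⟩, by rw [← hR]; omega⟩
  · rw [hcomb]
    exact ⟨by rw [norm_smul, norm_inv, norm_norm, inv_mul_cancel₀ hq0.ne'], rfl⟩
  · intro x hx
    rw [hcomb, real_inner_smul_left]
    have := hQn₁ x hx
    rw [inner_sub_right] at this
    exact mul_le_mul_of_nonneg_left (by linarith) (by positivity)
  · rw [hcomb, real_inner_smul_left]
    refine mul_lt_mul_of_pos_left ?_ (by positivity)
    have h1 : ⟪n₁, y - c⟫ = ⟪(ν' : EuclideanSpace ℝ (Fin N)), y - c⟫ := by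
      rw [hn₁e, inner_sub_right e, hye, sub_self, mul_zero, zero_add]
    rw [inner_sub_right] at h1
    linarith

/-- A full-dimensional polytope has a facet. -/
theorem exists_isPolytopeFace (hN : 0 < N) (hs : s.Finite)
    (hint : (interior (convexHull ℝ s)).Nonempty) : ∃ F, IsPolytopeFace (convexHull ℝ s) F := by
  have : Nonempty (Fin N) := ⟨⟨0, hN⟩⟩
  obtain ⟨c, hc⟩ := hint
  obtain ⟨ε, hε, hcε⟩ := Metric.isOpen_iff.1 isOpen_interior c hc
  set f : EuclideanSpace ℝ (Fin N) → EuclideanSpace ℝ (Fin N) := fun x => x - c with hf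
  have himg : f '' convexHull ℝ s = convexHull ℝ (f '' s) := by
    have := (AffineMap.id ℝ (EuclideanSpace ℝ (Fin N)) -
      AffineMap.const ℝ (EuclideanSpace ℝ (Fin N)) c).image_convexHull s
    exact this
  have hmem : ∀ x, x ∈ convexHull ℝ (f '' s) → x + c ∈ convexHull ℝ s := by
    intro x hx
    rw [← himg] at hx
    obtain ⟨x', hx', rfl⟩ := hx
    rwa [hf, sub_add_cancel]
  have hball : Metric.ball 0 ε ⊆ convexHull ℝ (f '' s) := by
    intro z hz
    rw [← himg]
    refine ⟨z + c, interior_subset (hcε ?_), add_sub_cancel_right z c⟩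
    rw [Metric.mem_ball, dist_eq_norm, add_sub_cancel_right]
    simpa using hz
  have hfin : (f '' s).Finite := hs.image f
  obtain ⟨y, hy⟩ : ∃ y, y ∉ convexHull ℝ (f '' s) := by
    by_contra! hall
    have hb := (hfin.isCompact_convexHull ℝ).isBounded
    rw [Set.eq_univ_of_forall hall] at hb
    exact NormedSpace.unbounded_univ ℝ (EuclideanSpace ℝ (Fin N)) hb
  obtain ⟨ν, hνs, hνy, hspan⟩ := exists_facet_normal_of_notMem hfin hε hball hy
  have hν0 : ν ≠ 0 := fun h0 => by
    rw [h0, inner_zero_left] at hνy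
    linarith
  have hQ : ∀ x ∈ convexHull ℝ s, ⟪ν, x - c⟫ ≤ 1 :=
    real_inner_le_of_mem_convexHull fun v hv => hνs _ ⟨v, hv, rfl⟩
  set G := {x ∈ convexHull ℝ s | ∀ y ∈ convexHull ℝ s, ⟪ν, y⟫ ≤ ⟪ν, x⟫} with hG
  have hsub : {v ∈ f '' s | ⟪ν, v⟫ = 1} ⊆ (fun x => x - c) '' G := by
    rintro _ ⟨⟨v, hv, rfl⟩, h1⟩
    refine ⟨v, ⟨subset_convexHull ℝ s hv, fun y hy => ?_⟩, rfl⟩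
    have h2 := hQ y hy
    rw [hf] at h1
    simp only [inner_sub_right] at h1 h2
    linarith
  have htop : (⊤ : Submodule ℝ (EuclideanSpace ℝ (Fin N))) ≤
      Submodule.span ℝ ((fun x => x - c) '' G) := hspan ▸ Submodule.span_mono hsub
  have hGne : G.Nonempty := by
    by_contra hne
    rw [Set.not_nonempty_iff_eq_empty] at hne
    rw [hne, Set.image_empty, Submodule.span_empty] at htop
    exact hν0 ((Submodule.mem_bot ℝ).1 (htop Submodule.mem_top))
  obtain ⟨p, hp⟩ := hGne
  have h1 := finrank_le_finrank_vectorSpan_add_one hp htop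
  rw [finrank_top, finrank_euclideanSpace_fin] at h1
  have h2 := Submodule.finrank_mono (vectorSpan_le_orthogonal (G := G) (n := ν)
    fun a ha b hb => le_antisymm (hb.2 a ha.1) (ha.2 b hb.1))
  have h3 := finrank_orthogonal_span_singleton_add_one hν0
  rw [finrank_euclideanSpace_fin] at h3
  exact ⟨G, ⟨p, hp⟩, isExposed_setOf_inner_le _ _, by omega⟩

end AdjacentFacets

/-! ### From facets of a polytope to admissible normals. -/

section ObservedFacets

open InnerProductGeometry

variable {N : ℕ}

/-- The inscribed disk of a compact set is attained. -/
theorem exists_inscribed_disk {F : Set (EuclideanSpace ℝ (Fin N))} (hF : IsCompact F) {l : ℝ}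
    (hl : 0 < l) (hlF : l ≤ inscriptionSize F) :
    ∃ c ∈ F, ∀ z ∈ vectorSpan ℝ F, ‖z‖ ≤ l / 2 → c + z ∈ F := by
  set A := {δ : ℝ | 0 ≤ δ ∧ ∃ c ∈ affineSpan ℝ F,
    Metric.closedBall c (δ / 2) ∩ (affineSpan ℝ F : Set (EuclideanSpace ℝ (Fin N))) ⊆ F} with hA
  have hAsup : l ≤ sSup A := hlF
  -- The default value `sSup ∅ = 0` is excluded by l > 0.
  have hAne : A.Nonempty := by
    by_contra hne
    rw [Set.not_nonempty_iff_eq_empty] at hne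
    rw [hne, Real.sSup_empty] at hAsup
    linarith
  -- Disks shrunk by factors a k < 1 exist by definition of the supremum; their centres subconverge
  -- in the compact set `F`.
  set a : ℕ → ℝ := fun k => (k : ℝ) / (k + 1) with ha
  have ha1 : ∀ k, a k < 1 := fun k => (div_lt_one (by positivity)).2 (by linarith)
  have ha0 : ∀ k, 0 ≤ a k := fun k => by positivity
  have hex : ∀ k : ℕ, ∃ c ∈ F, ∀ z ∈ vectorSpan ℝ F, ‖z‖ ≤ l / 2 → c + a k • z ∈ F := by
    intro k
    have hlt : a k * l < sSup A := by nlinarith [ha1 k]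
    obtain ⟨δ, ⟨hδ0, c, hc, hδ⟩, hkδ⟩ := exists_lt_of_lt_csSup hAne hlt
    refine ⟨c, hδ ⟨Metric.mem_closedBall_self (by linarith), hc⟩, fun z hz hzl => hδ ⟨?_, ?_⟩⟩
    · rw [mem_closedBall_iff_norm, add_sub_cancel_left, norm_smul, Real.norm_of_nonneg (ha0 k)]
      nlinarith [mul_le_mul_of_nonneg_left hzl (ha0 k)]
    · rw [add_comm, SetLike.mem_coe, ← vadd_eq_add]
      refine AffineSubspace.vadd_mem_of_mem_direction ?_ hc
      rw [direction_affineSpan]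
      exact Submodule.smul_mem _ _ hz
  choose c hcF hc using hex
  obtain ⟨c₀, hc₀, φ, hφ, hlim⟩ := hF.tendsto_subseq hcF
  refine ⟨c₀, hc₀, fun z hz hzl => ?_⟩
  have hlima : Filter.Tendsto (fun k => a (φ k)) Filter.atTop (nhds 1) :=
    tendsto_natCast_div_add_atTop (1 : ℝ) |>.comp hφ.tendsto_atTop
  have hlim2 : Filter.Tendsto (fun k => c (φ k) + a (φ k) • z) Filter.atTop
      (nhds (c₀ + (1 : ℝ) • z)) := hlim.add (hlima.smul_const z)
  rw [one_smul] at hlim2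
  exact hF.isClosed.mem_of_tendsto hlim2 (Filter.Eventually.of_forall fun k => hc _ z hz hzl)

/-- The exposing functional is normalised; were it zero, `F` would be all of `Q` and
full-dimensional. -/
theorem IsPolytopeFace.exists_isOutwardUnitNormal {Q F : Set (EuclideanSpace ℝ (Fin N))}
    (hF : IsPolytopeFace Q F) (hint : (interior Q).Nonempty) :
    ∃ e, IsOutwardUnitNormal Q F e := by
  obtain ⟨hne, hexp, hfr⟩ := hF
  obtain ⟨l, hl⟩ := hexp hne
  set e₀ := (InnerProductSpace.toDual ℝ (EuclideanSpace ℝ (Fin N))).symm l with he₀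
  have hl' : ∀ x, ⟪e₀, x⟫ = l x := fun x => InnerProductSpace.toDual_symm_apply
  have he₀0 : e₀ ≠ 0 := by
    intro h0
    have hFQ : F = Q := by
      rw [hl]
      ext x
      refine ⟨fun h => h.1, fun h => ⟨h, fun y _ => ?_⟩⟩
      rw [← hl', ← hl', h0, inner_zero_left, inner_zero_left]
    have htop : vectorSpan ℝ F = ⊤ := by
      have := Convex.interior_nonempty_iff_affineSpan_eq_top
        (convex_convexHull ℝ Q) |>.1 (hint.mono (interior_mono (subset_convexHull ℝ Q)))
      rw [hFQ, ← direction_affineSpan, ← affineSpan_convexHull, this, AffineSubspace.direction_top]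
    rw [htop, finrank_top, finrank_euclideanSpace_fin] at hfr
    omega
  have hn : 0 < ‖e₀‖ := norm_pos_iff.2 he₀0
  refine ⟨‖e₀‖⁻¹ • e₀, by rw [norm_smul, norm_inv, norm_norm, inv_mul_cancel₀ hn.ne'], ?_⟩
  rw [hl]
  ext x
  simp only [Set.mem_ofPred_eq, real_inner_smul_left, hl', mul_le_mul_iff_right₀ (inv_pos.2 hn)]

theorem IsPolytopeFace.vectorSpan_eq {Q F : Set (EuclideanSpace ℝ (Fin N))}
    (hF : IsPolytopeFace Q F) {e : EuclideanSpace ℝ (Fin N)} (he : IsOutwardUnitNormal Q F e) :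
    vectorSpan ℝ F = (ℝ ∙ e)ᗮ := by
  have he0 : e ≠ 0 := norm_ne_zero_iff.1 (by rw [he.1]; exact one_ne_zero)
  have hfr := finrank_orthogonal_span_singleton_add_one he0
  rw [finrank_euclideanSpace_fin] at hfr
  refine Submodule.eq_of_le_of_finrank_eq (vectorSpan_le_orthogonal fun a ha b hb => ?_) ?_
  · rw [he.2] at ha hb
    exact le_antisymm (hb.2 a ha.1) (ha.2 b hb.1)
  · have := hF.2.2
    omega

/-- As D = sin (arccos C), the expression is sin (arccos C - α). -/
theorem sin_sub_nonneg_of_le_arccos {C D α : ℝ} (hD : 0 < D) (hCD : C ^ 2 + D ^ 2 = 1)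
    (hα0 : 0 ≤ α) (hα : α ≤ Real.arccos C) : 0 ≤ Real.cos α * D - Real.sin α * C := by
  have hC : -1 ≤ C ∧ C ≤ 1 := abs_le.1 ((sq_le_one_iff_abs_le_one C).1 (by nlinarith))
  have h1 : Real.cos (Real.arccos C) = C := Real.cos_arccos hC.1 hC.2
  have h2 : Real.sin (Real.arccos C) = D := by
    rw [Real.sin_arccos, show 1 - C ^ 2 = D ^ 2 by linarith, Real.sqrt_sq hD.le]
  have h3 : 0 ≤ Real.sin (Real.arccos C - α) :=
    Real.sin_nonneg_of_nonneg_of_le_pi (by linarith) (by linarith [Real.arccos_le_pi C])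
  rw [Real.sin_sub, h1, h2] at h3
  linarith

theorem inner_smul_add_smul {E : Type*} [NormedAddCommGroup E] [InnerProductSpace ℝ E] (e ν x : E)
    (C D : ℝ) : ⟪C • e + D • ν, x⟫ = C * ⟪e, x⟫ + D * ⟪ν, x⟫ := by
  rw [inner_add_left, real_inner_smul_left, real_inner_smul_left]

theorem angle_smul_add_smul {E : Type*} [NormedAddCommGroup E] [InnerProductSpace ℝ E] {e ν : E}
    {C D : ℝ} (he : ‖e‖ = 1) (hνe : ⟪ν, e⟫ = 0) (hn : ‖C • e + D • ν‖ = 1) :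
    angle e (C • e + D • ν) = Real.arccos C := by
  rw [angle, he, hn, real_inner_comm, inner_smul_add_smul, hνe, real_inner_self_eq_norm_sq, he]
  norm_num

/-- A ray with a positive component along every admissible normal meets the facet. -/
theorem ray_meets_facet {s : Set (EuclideanSpace ℝ (Fin N))} (hs : s.Finite)
    (hint : (interior (convexHull ℝ s)).Nonempty) {F : Set (EuclideanSpace ℝ (Fin N))}
    {e : EuclideanSpace ℝ (Fin N)} (he : IsOutwardUnitNormal (convexHull ℝ s) F e)
    {c : EuclideanSpace ℝ (Fin N)} (hcF : c ∈ F) {r : ℝ} (hr : 0 < r)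
    (hdisk : ∀ z, ⟪e, z⟫ = 0 → ‖z‖ ≤ r → c + z ∈ F) {α : ℝ} (hα0 : 0 ≤ α)
    (hα : ∀ G n, IsPolytopeFace (convexHull ℝ s) G → AreAdjacentFaces F G →
      IsOutwardUnitNormal (convexHull ℝ s) G n → α ≤ angle e n)
    {x : EuclideanSpace ℝ (Fin N)} (hx : x ∈ convexHull ℝ s) {h : ℝ} (hh : 0 < h)
    (hhx : ⟪e, c⟫ - ⟪e, x⟫ = h) {v : EuclideanSpace ℝ (Fin N)} (hve : 0 < ⟪v, e⟫)
    (hv : ∀ m, AdmissibleNormal e (r⁻¹ • (c - x - h • e)) (h / r) (Real.sin α) (Real.cos α) m →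
      0 < ⟪v, m⟫) : (rayFrom x v ∩ F).Nonempty := by
  have hee : ⟪e, e⟫ = 1 := by rw [real_inner_self_eq_norm_sq, he.1, one_pow]
  -- The point where the ray crosses the hyperplane of `F`. Were it outside `F`, an adjacent facet
  -- would cut it off, and the hyperplane through `x` and the common ridge would have an admissible
  -- normal `m` with ⟪v, m⟫ ≤ 0.
  refine ⟨x + (h / ⟪v, e⟫) • v, ⟨_, by positivity, rfl⟩, ?_⟩
  by_contra hyF
  have hye : ⟪e, x + (h / ⟪v, e⟫) • v⟫ = ⟪e, c⟫ := by
    rw [inner_add_right, real_inner_smul_right, real_inner_comm v e, div_mul_cancel₀ _ hve.ne']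
    linarith
  obtain ⟨ν, C, D, G, b, hν, hνe, hD, hCD, hG, hadj, hn, hb, hby⟩ :=
    exists_adjacent_facet_of_notMem hs hint he.1 he.2 hcF hr
      (fun z hz hzr => hdisk z hz hzr.le) hyF hye
  have hang := hα G _ hG hadj hn
  rw [angle_smul_add_smul he.1 hνe hn.1] at hang
  have hsc := sin_sub_nonneg_of_le_arccos hD hCD hα0 hang
  have hνν : ⟪ν, ν⟫ = 1 := by rw [real_inner_self_eq_norm_sq, hν, one_pow]
  have heν : ⟪e, ν⟫ = 0 := by rw [real_inner_comm, hνe]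
  have hFQ : F ⊆ convexHull ℝ s := fun y hy => by
    rw [he.2] at hy
    exact hy.1
  -- signed distance from the projection of the observation point to the ridge
  set a := (b - C * ⟪e, c⟫) / D - ⟪ν, x⟫ with ha
  have haD : a * D = b - C * ⟪e, c⟫ - D * ⟪ν, x⟫ := by
    rw [ha]
    field_simp
  have hax : -(h * C) ≤ a * D := by
    have := hb x hx
    rw [inner_smul_add_smul] at this
    rw [haD]
    have e1 : ⟪e, c⟫ = ⟪e, x⟫ + h := by linarith
    rw [e1]
    linarith
  have har : r + ⟪ν, c - x - h • e⟫ ≤ a := by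
    have h1 := hb _ (hFQ (hdisk (r • ν) (by rw [real_inner_smul_right, heν, mul_zero])
      (by rw [norm_smul, hν, mul_one, Real.norm_of_nonneg hr.le])))
    rw [inner_smul_add_smul, inner_add_right, inner_add_right, real_inner_smul_right,
      real_inner_smul_right, heν, hνν] at h1
    rw [inner_sub_right, inner_sub_right, real_inner_smul_right, hνe]
    refine le_of_mul_le_mul_right ?_ hD
    rw [haD]
    linarith
  set q := √(a ^ 2 + h ^ 2) with hq
  have hq2 : q ^ 2 = a ^ 2 + h ^ 2 := Real.sq_sqrt (by positivity)
  have hq0 : 0 < q := Real.sqrt_pos.2 (by positivity)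
  have hadm := hv ((a / q) • e - (h / q) • ν) ⟨ν, a / q, h / q, hν, hνe, by positivity, ?_, ?_, ?_, rfl⟩
  · rw [inner_sub_right, real_inner_smul_right, real_inner_smul_right] at hadm
    have h1 : 0 < (a * ⟪v, e⟫ - h * ⟪v, ν⟫) / q := by
      refine hadm.trans_eq ?_
      ring
    have h2 : h * ⟪v, ν⟫ < a * ⟪v, e⟫ := by
      have := (div_pos_iff_of_pos_right hq0).1 h1
      linarith
    rw [inner_smul_add_smul, hye, inner_add_right, real_inner_smul_right, real_inner_comm v ν] at hby
    have h3 : a * D < D * (h / ⟪v, e⟫ * ⟪v, ν⟫) := by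
      rw [haD]
      linarith
    have h4 : a < h / ⟪v, e⟫ * ⟪v, ν⟫ := by
      rw [mul_comm] at h3
      exact lt_of_mul_lt_mul_left h3 hD.le
    rw [div_mul_eq_mul_div, lt_div_iff₀ hve] at h4
    linarith
  · rw [div_pow, div_pow, ← add_div, ← hq2, div_self (by positivity)]
  · have h1 : 0 ≤ (Real.sin α * a + Real.cos α * h) * D := by
      have h2 : 0 ≤ Real.sin α := Real.sin_nonneg_of_nonneg_of_le_pi hα0
        (hang.trans (Real.arccos_le_pi C))
      nlinarith [mul_le_mul_of_nonneg_left hax h2, mul_nonneg hh.le hsc]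
    have h3 : 0 ≤ Real.sin α * a + Real.cos α * h := nonneg_of_mul_nonneg_left h1 hD
    have : Real.sin α * (a / q) + Real.cos α * (h / q) = (Real.sin α * a + Real.cos α * h) / q := by
      ring
    rw [this]
    positivity
  · rw [real_inner_smul_right]
    have e1 : h / q * (1 + r⁻¹ * ⟪ν, c - x - h • e⟫) =
        h / (q * r) * (r + ⟪ν, c - x - h • e⟫) := by field_simp
    have e2 : h / r * (a / q) = h / (q * r) * a := by field_simp
    rw [e1, e2]
    exact mul_le_mul_of_nonneg_left har (by positivity)

theorem exists_unit_orthogonal (hN : 2 ≤ N) {e : EuclideanSpace ℝ (Fin N)} (he : ‖e‖ = 1) :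
    ∃ z : EuclideanSpace ℝ (Fin N), ‖z‖ = 1 ∧ ⟪e, z⟫ = 0 := by
  have he0 : e ≠ 0 := norm_ne_zero_iff.1 (by rw [he]; exact one_ne_zero)
  have hfr := finrank_orthogonal_span_singleton_add_one he0
  rw [finrank_euclideanSpace_fin] at hfr
  obtain ⟨z, hzW, hz, -⟩ := exists_unit_inner_nonpos (ℝ ∙ e)ᗮ ∅ (by simp) (by omega)
  exact ⟨z, hz, Submodule.mem_orthogonal_singleton_iff_inner_right.1 hzW⟩

open Classical in
/-- A facet with an inscribed disk of radius `r` is seen from every point of the polytope in at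
least `N` directions of a dense enough set of directions. -/
theorem le_card_rays_meeting_facet (hN : 2 ≤ N) {s : Set (EuclideanSpace ℝ (Fin N))} (hs : s.Finite)
    (hint : (interior (convexHull ℝ s)).Nonempty) {F : Set (EuclideanSpace ℝ (Fin N))}
    {e : EuclideanSpace ℝ (Fin N)} (he : IsOutwardUnitNormal (convexHull ℝ s) F e)
    {c : EuclideanSpace ℝ (Fin N)} (hcF : c ∈ F) {r : ℝ} (hr : 0 < r)
    (hdisk : ∀ z, ⟪e, z⟫ = 0 → ‖z‖ ≤ r → c + z ∈ F) {α : ℝ} (hα0 : 0 < α)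
    (hα : ∀ G n, IsPolytopeFace (convexHull ℝ s) G → AreAdjacentFaces F G →
      IsOutwardUnitNormal (convexHull ℝ s) G n → α ≤ angle e n)
    {d δ : ℝ} (hd : ∀ y ∈ convexHull ℝ s, ∀ z ∈ convexHull ℝ s, dist y z ≤ d) (hd0 : 0 < d)
    (hδ0 : 0 < δ) (hδ : 6 * δ ≤ Real.pi / 2) (hsin : Real.sin (6 * δ) * d ≤ 2 * r * Real.sin α)
    {V : Finset (EuclideanSpace ℝ (Fin N))} (hV : ∀ v ∈ V, ‖v‖ = 1)
    (hcov : ∀ u : EuclideanSpace ℝ (Fin N), ‖u‖ = 1 → ∃ v ∈ V, angle u v < δ)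
    {x : EuclideanSpace ℝ (Fin N)} (hx : x ∈ convexHull ℝ s) :
    N ≤ (V.filter (· ∈ {v | (rayFrom x v ∩ F).Nonempty})).card := by
  have hπ := Real.pi_pos
  have hE : Module.finrank ℝ (EuclideanSpace ℝ (Fin N)) = N := finrank_euclideanSpace_fin
  have hE2 : 2 ≤ Module.finrank ℝ (EuclideanSpace ℝ (Fin N)) := by rw [hE]; exact hN
  have hee : ⟪e, e⟫ = 1 := by rw [real_inner_self_eq_norm_sq, he.1, one_pow]
  have hFQ : F ⊆ convexHull ℝ s := fun y hy => by
    rw [he.2] at hy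
    exact hy.1
  have hce : ∀ y ∈ convexHull ℝ s, ⟪e, y⟫ ≤ ⟪e, c⟫ := by
    rw [he.2] at hcF
    exact hcF.2
  -- From a point of `F` every ray meets `F` at t = 0, so only the size of `V` is at stake.
  by_cases hxF : x ∈ F
  · have h1 := finrank_le_card_of_cap (K := {v | (rayFrom x v ∩ F).Nonempty}) hV hcov hδ0
      (by linarith) hE2 he.1 fun v _ _ => ⟨x, ⟨0, le_rfl, by simp⟩, hxF⟩
    rwa [hE] at h1
  obtain ⟨z₀, hz₀, hz₀e⟩ := exists_unit_orthogonal hN he.1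
  set h := ⟪e, c⟫ - ⟪e, x⟫ with hh
  have hh0 : 0 < h := by
    refine lt_of_le_of_ne (by linarith [hce x hx]) fun h0 => hxF ?_
    rw [he.2]
    exact ⟨hx, fun y hy => (hce y hy).trans (by linarith)⟩
  set w₀ := c - x - h • e with hw₀
  have hw₀e : ⟪e, w₀⟫ = 0 := by
    rw [hw₀, inner_sub_right, inner_sub_right, real_inner_smul_right, hee]
    linarith
  set w := r⁻¹ • w₀ with hw
  have hwe : ⟪e, w⟫ = 0 := by rw [hw, real_inner_smul_right, hw₀e, mul_zero]
  have hwn : ‖w‖ = ‖w₀‖ / r := by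
    rw [hw, norm_smul, norm_inv, Real.norm_of_nonneg hr.le, inv_mul_eq_div]
  -- the farthest point of the disk
  have hfar : h ^ 2 + (‖w₀‖ + r) ^ 2 ≤ d ^ 2 := by
    obtain ⟨z, hz, hze, hzw⟩ : ∃ z : EuclideanSpace ℝ (Fin N), ‖z‖ = 1 ∧ ⟪e, z⟫ = 0 ∧
        ⟪w₀, z⟫ = ‖w₀‖ := by
      rcases eq_or_ne w₀ 0 with h0 | h0
      · exact ⟨z₀, hz₀, hz₀e, by rw [h0, inner_zero_left, norm_zero]⟩
      · have hn := norm_pos_iff.2 h0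
        refine ⟨‖w₀‖⁻¹ • w₀, ?_, ?_, ?_⟩
        · rw [norm_smul, norm_inv, norm_norm, inv_mul_cancel₀ hn.ne']
        · rw [real_inner_smul_right, hw₀e, mul_zero]
        · rw [real_inner_smul_right, real_inner_self_eq_norm_sq, sq, inv_mul_cancel_left₀ hn.ne']
    have hmem : c + r • z ∈ F := hdisk _ (by rw [real_inner_smul_right, hze, mul_zero])
      (by rw [norm_smul, hz, mul_one, Real.norm_of_nonneg hr.le])
    have h1 := hd _ (hFQ hmem) x hx
    have e1 : c + r • z - x = h • e + (w₀ + r • z) := by rw [hw₀]; module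
    have e2 : ‖c + r • z - x‖ ^ 2 = h ^ 2 + (‖w₀‖ + r) ^ 2 := by
      rw [e1, norm_smul_add_sq he.1 (w := w₀ + r • z) (R := ‖w₀ + r • z‖)
        (by rw [inner_add_right, real_inner_smul_right, hw₀e, hze]; ring) rfl, norm_add_sq_real,
        real_inner_smul_right, hzw, norm_smul, hz, Real.norm_of_nonneg hr.le]
      ring
    rw [dist_eq_norm] at h1
    rw [← e2]
    exact pow_le_pow_left₀ (norm_nonneg _) h1 2
  -- Capping the angle makes its cosine nonnegative, does not decrease its sine and preserves the
  -- dihedral bound.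
  set α' := min α (Real.pi / 2) with hα'
  have hα'0 : 0 < α' := lt_min hα0 (by linarith)
  have hα'2 : α' ≤ Real.pi / 2 := min_le_right _ _
  have hS : 0 < Real.sin α' := Real.sin_pos_of_pos_of_lt_pi hα'0 (by linarith)
  have hsinα : Real.sin α ≤ Real.sin α' := by
    rcases min_choice α (Real.pi / 2) with h1 | h1
    · rw [hα', h1]
    · rw [hα', h1, Real.sin_pi_div_two]
      exact Real.sin_le_one α
  set D := √((h / r) ^ 2 + (‖w₀‖ / r + 1) ^ 2) with hD
  have hD2 : D ^ 2 = (h / r) ^ 2 + (‖w₀‖ / r + 1) ^ 2 := Real.sq_sqrt (by positivity)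
  have hD0 : 0 < D := Real.sqrt_pos.2 (by positivity)
  have hrD : r * D ≤ d := by
    refine abs_le_of_sq_le_sq' ?_ hd0.le |>.2
    rw [mul_pow, hD2]
    refine le_trans (le_of_eq ?_) hfar
    field_simp
  have hsin6 : 0 ≤ Real.sin (6 * δ) := Real.sin_nonneg_of_nonneg_of_le_pi (by linarith) (by linarith)
  have hsinD : Real.sin (6 * δ) * D ≤ 2 * Real.sin α' := by
    have h1 : r * (Real.sin (6 * δ) * D) ≤ r * (2 * Real.sin α') := by
      calc r * (Real.sin (6 * δ) * D) = Real.sin (6 * δ) * (r * D) := by ring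
        _ ≤ Real.sin (6 * δ) * d := mul_le_mul_of_nonneg_left hrD hsin6
        _ ≤ 2 * r * Real.sin α := hsin
        _ ≤ 2 * r * Real.sin α' := mul_le_mul_of_nonneg_left hsinα (by positivity)
        _ = _ := by ring
    exact le_of_mul_le_mul_left h1 hr
  -- The case B = 0: `e` itself is admissible, which forces the ray to rise towards the facet.
  have hadm : AdmissibleNormal e w (h / r) (Real.sin α') (Real.cos α') e :=
    ⟨z₀, 1, 0, hz₀, by rw [real_inner_comm, hz₀e], le_rfl, by norm_num, by linarith,
      by rw [zero_mul, mul_one]; positivity, by rw [one_smul, zero_smul, sub_zero]⟩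
  have hmain := finrank_le_card_of_admissible (K := {v | (rayFrom x v ∩ F).Nonempty})
    hV hcov hE2 (fun v _ hv => ?_) he.1 hwe hwn (div_pos hh0 hr) hS
    (Real.cos_nonneg_of_mem_Icc ⟨by linarith, hα'2⟩) (Real.sin_sq_add_cos_sq α') hδ0 hδ hD0 hD2
    hsinD
  · rwa [hE] at hmain
  · exact ray_meets_facet hs hint he hcF hr hdisk hα'0.le
      (fun G n hG hadj hn => (min_le_left _ _).trans (hα G n hG hadj hn)) hx hh0 hh.symm
      (hv e hadm) hv

end ObservedFacets

/-! ### Assembling the theorem. -/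

theorem theorem2 (N : ℕ) (hN : 2 ≤ N) (d l α : ℝ) (hd : 0 < d) (hl : 0 < l) (hα : 0 < α)
    (Q : Set (EuclideanSpace ℝ (Fin N))) (hQ : Q ∈ polytopeClass N d l α) :
    ∃ (M : ℕ) (v : Fin M → Metric.sphere (0 : EuclideanSpace ℝ (Fin N)) 1),
      Function.Injective v ∧
      (∀ x ∈ Q, ∀ F, IsPolytopeFace Q F →
        N ≤ {i : Fin M | (rayFrom x (v i) ∩ F).Nonempty}.ncard) ∧
      (M : ℝ) ≤ Real.sqrt (2 * Real.pi * N) *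
        (1 / Real.sin (thetaMin d l α / 12)) ^ (N - 1) := by
  classical
  obtain ⟨⟨⟨s, rfl⟩, hint⟩, hdiam, hins, hang⟩ := hQ
  have hπ := Real.pi_pos
  have hs : (s : Set (EuclideanSpace ℝ (Fin N))).Finite := s.finite_toSet
  set Q := convexHull ℝ (s : Set (EuclideanSpace ℝ (Fin N))) with hQ
  have hQc : IsCompact Q := hs.isCompact_convexHull ℝ
  have hdist : ∀ y ∈ Q, ∀ z ∈ Q, dist y z ≤ d := fun y hy z hz =>
    (Metric.dist_le_diam_of_mem hQc.isBounded hy hz).trans hdiam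
  have hdata : ∀ F, IsPolytopeFace Q F → ∃ e c, IsOutwardUnitNormal Q F e ∧ c ∈ F ∧
      ∀ z, ⟪e, z⟫ = 0 → ‖z‖ ≤ l / 2 → c + z ∈ F := by
    intro F hF
    obtain ⟨e, he⟩ := hF.exists_isOutwardUnitNormal hint
    obtain ⟨c, hc, hdisk⟩ := exists_inscribed_disk (hF.2.1.isCompact hQc) hl (hins F hF)
    refine ⟨e, c, he, hc, fun z hz => hdisk z ?_⟩
    rw [hF.vectorSpan_eq he]
    exact Submodule.mem_orthogonal_singleton_iff_inner_right.2 hz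
  -- These put (l / d) sin α in (0, 1], so that arcsin is not truncated. The normal of an adjacent
  -- facet is not -e, as its component D along ν is positive; and a diameter of the inscribed disk
  -- lies in Q.
  obtain ⟨hαπ, hld⟩ : α < Real.pi ∧ l ≤ d := by
    obtain ⟨F, hF⟩ := exists_isPolytopeFace (by omega : 0 < N) hs hint
    obtain ⟨e, c, he, hcF, hdisk⟩ := hdata F hF
    have hFQ : F ⊆ Q := fun y hy => by
      rw [he.2] at hy
      exact hy.1
    obtain ⟨z, hz, hze⟩ := exists_unit_orthogonal hN he.1
    constructor
    · have hyF : c + (d + 1) • z ∉ F := fun hy => by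
        have := hdist _ (hFQ hy) c (hFQ hcF)
        rw [dist_eq_norm, add_sub_cancel_left, norm_smul, hz, Real.norm_of_nonneg (by linarith)] at this
        linarith
      obtain ⟨ν, C, D, G, b, hν, hνe, hD, hCD, hG, hadj, hn, -, -⟩ :=
        exists_adjacent_facet_of_notMem hs hint he.1 he.2 hcF (half_pos hl)
          (fun z hz hzr => hdisk z hz hzr.le) hyF
          (by rw [inner_add_right, real_inner_smul_right, hze, mul_zero, add_zero])
      have h1 := hang F G e _ hF hG hadj he hn
      rw [angle_smul_add_smul he.1 hνe hn.1] at h1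
      refine h1.trans_lt ((Real.arccos_le_pi C).lt_of_ne fun h2 => ?_)
      rw [Real.arccos_eq_pi] at h2
      nlinarith
    · have h1 := hdist _ (hFQ (hdisk ((l / 2) • z) (by rw [real_inner_smul_right, hze, mul_zero])
        (by rw [norm_smul, hz, mul_one, Real.norm_of_nonneg (by linarith)]))) _
        (hFQ (hdisk (-((l / 2) • z)) (by rw [inner_neg_right, real_inner_smul_right, hze]; simp)
        (by rw [norm_neg, norm_smul, hz, mul_one, Real.norm_of_nonneg (by linarith)])))
      have e1 : c + (l / 2) • z - (c + -((l / 2) • z)) = l • z := by module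
      rwa [dist_eq_norm, e1, norm_smul, hz, mul_one, Real.norm_of_nonneg hl.le] at h1
  have hsinα : 0 < Real.sin α := Real.sin_pos_of_pos_of_lt_pi hα hαπ
  have hratio : l / d * Real.sin α ≤ 1 :=
    mul_le_one₀ ((div_le_one hd).2 hld) hsinα.le (Real.sin_le_one α)
  have hratio0 : 0 < l / d * Real.sin α := by positivity
  set θ := thetaMin d l α with hθ
  have hθ0 : 0 < θ := Real.arcsin_pos.2 hratio0
  have hθ2 : θ ≤ Real.pi / 2 := Real.arcsin_le_pi_div_two _
  have hsinθ : Real.sin θ = l / d * Real.sin α := Real.sin_arcsin (by linarith) hratio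
  -- With 6δ = θ_min, sin 6δ · d = 2 (l / 2) sin α, where l / 2 is the radius of the disk.
  set δ := θ / 6 with hδ
  have h6δ : 6 * δ = θ := by rw [hδ]; ring
  obtain ⟨n, rfl⟩ : ∃ n, N = n + 1 := ⟨N - 1, by omega⟩
  obtain ⟨V, hV, hcov, hcard⟩ := exists_dense_directions (n := n) (by omega) (δ := δ)
    (by positivity) (by linarith)
  set φ := V.equivFin.symm with hφ
  have hvinj : Function.Injective fun i => (φ i : EuclideanSpace ℝ (Fin (n + 1))) :=
    Subtype.val_injective.comp φ.injective
  refine ⟨V.card, fun i => ⟨φ i, by rw [mem_sphere_zero_iff_norm]; exact hV _ (φ i).2⟩,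
    fun i j hij => hvinj (Subtype.mk.inj hij), fun x hx F hF => ?_, ?_⟩
  · obtain ⟨e, c, he, hcF, hdisk⟩ := hdata F hF
    have h1 := le_card_rays_meeting_facet hN hs hint he hcF (half_pos hl) hdisk hα
      (fun G n hG hadj hn => hang F G e n hF hG hadj he hn) hdist hd (δ := δ) (by positivity)
      (by rw [h6δ]; exact hθ2) (by rw [h6δ, hsinθ]; field_simp; exact le_rfl) hV hcov hx
    rw [← Set.ncard_image_of_injective _ hvinj]
    have himg : (fun i => (φ i : EuclideanSpace ℝ (Fin (n + 1)))) ''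
        {i | (rayFrom x (φ i) ∩ F).Nonempty} =
        (V.filter (· ∈ {v | (rayFrom x v ∩ F).Nonempty}) : Set _) := by
      ext v
      simp only [Set.mem_image, Set.mem_ofPred_eq, Finset.coe_filter]
      constructor
      · rintro ⟨i, hi, rfl⟩
        exact ⟨(φ i).2, hi⟩
      · rintro ⟨hvV, hv⟩
        exact ⟨φ.symm ⟨v, hvV⟩, by simpa using hv, by simp⟩
    rw [himg, Set.ncard_coe_finset]
    exact h1
  · have e1 : δ / 2 = θ / 12 := by rw [hδ]; ring
    rw [e1] at hcard
    simpa using hcard
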